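/- **Setting.** All logarithms are to base 2. Let $(X,Y,Z)$ be a discrete memoryless source: $\mathcal X,\mathcal Y,\mathcal Z$ are finite alphabets, $P_{XYZ}$ is a probability mass function on $\mathcal X\times\mathcal Y\times\mathcal Z$, and $(X^n,Y^n,Z^n)$ is i.i.d. $\sim P_{XYZ}$. Alice observes $X^n$, Bob $Y^n$ and the warden Willie $Z^n$. *Protocols.* Fix $k\ge 0$ and a finite alphabet $\mathcal A$. A key generation protocol of block length $n$ with key set $\mathcal K$ works as follows. Alice and Bob have finite-valued private randomness $R_X,R_Y$, independent of each other and of the source. They exchange $nk$ public symbols in $\mathcal A$; each symbol is sent by the terminal prescribed by a fixed schedule, as a function of that terminal's observation and private randomness and of all earlier public symbols. The whole public discussion $\mathbf F=(F_1,\dots,F_n)\in(\mathcal A^k)^n$, grouped into $n$ letters of $k$ symbols, is seen by everybody. Finally Alice computes $K\in\mathcal K$ from $(X^n,R_X,\mathbf F)$ and Bob computes $\hat K\in\mathcal K$ from $(Y^n,R_Y,\mathbf F)$. *Meaningless discussion.* A conceptual wiretap channel consists of a finite-valued input $U\sim P_U$ independent of $(X,Y,Z)$ and a public letter $F\in\mathcal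 A^k$ which is a function of $(U,X)$ or a function of $(U,Y)$; its transition probabilities to Willie are $P_{ZF|U}$. It is required that $F$ and $Z$ be independent when $U\sim P_U$. The law of Willie's observation under a meaningless discussion is $$Q_{Z^n\mathbf F}(z^n,\mathbf f)=\sum_{u^n}\prod_{i=1}^n P_{ZF|U}(z_i,f_i|u_i)\,P_U(u_i).$$ *Capacity.* A rate $R\ge 0$ is achievable if there are $k$, $\mathcal A$ and a conceptual wiretap channel such that for every $\epsilon>0$ and all sufficiently large $n$ there is a protocol of block length $n$ with $|\mathcal K|=\lceil 2^{nR}\rceil$ and $$\Pr(K\ne\hat K)\le\epsilon,\qquad \log|\mathcal K|-H(K)\le\epsilon,$$ $$D(P_{KZ^n\mathbf F}\,\|\,P_KP_{Z^n\mathbf F})+D(P_{Z^n\mathbf F}\,\|\,Q_{Z^n\mathbf F})\le\epsilon$$ (reliability, uniformity, and effective secrecy, i.e. non-confusion plus non-stealth). The stealthy secret key capacity $C_{SK}^{Eff}$ is the supremum of the achievable rates. **Theorem.** For every discrete memoryless source $(\mathcal X,\mathcal Y,\mathcal Z,P_{XYZ})$, $$\max\{I(X;Y)-I(X;Z),\ I(Y;X)-I(Y;Z)\}\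 \le\ C_{SK}^{Eff}\ \le\ \min\{I(X;Y),\ I(X;Y|Z)\}.$$ -/

import Mathlib

noncomputable section

namespace StealthyKey

/-! All alphabets are finite, a probability mass function on `α` is an element of
`stdSimplex ℝ α`, and all logarithms are to base 2. -/

open Classical in
/-- The law (probability mass function) of the random variable `g` on a finite probability space
with probability mass function `p`. -/
def law {α β : Type*} [Fintype α] (p : α → ℝ) (g : α → β) (b : β) : ℝ :=
  ∑ a, if g a = b then p a else 0

/-- Shannon entropy (in bits) of a probability mass function. -/
def entropy {α : Type*} [Fintype α] (p : α → ℝ) : ℝ :=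
  ∑ a, -(p a * Real.logb 2 (p a))

open Classical in
/-- Divergence `D(p‖q)` (in bits), equal to `+∞` unless `p` is absolutely continuous with
respect to `q`. -/
def divergence {α : Type*} [Fintype α] (p q : α → ℝ) : EReal :=
  if ∀ a, q a = 0 → p a = 0 then ((∑ a, p a * Real.logb 2 (p a / q a) : ℝ) : EReal) else ⊤

/-- Mutual information `I(A;B)` (in bits) of a pair with joint probability mass function `p`. -/
def mutualInfo {α β : Type*} [Fintype α] [Fintype β] (p : α × β → ℝ) : ℝ :=
  ∑ s, p s * Real.logb 2 (p s / (law p Prod.fst s.1 * law p Prod.snd s.2))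

/-- Conditional mutual information `I(A;B|C)` (in bits) of a triple with joint probability mass
function `p`. -/
def condMutualInfo {α β γ : Type*} [Fintype α] [Fintype β] [Fintype γ] (p : α × β × γ → ℝ) : ℝ :=
  ∑ s, p s * Real.logb 2 ((law p (fun t => t.2.2) s.2.2 * p s) /
    (law p (fun t => (t.1, t.2.2)) (s.1, s.2.2) * law p (fun t => t.2) s.2))

/-- A conceptual wiretap channel, single letter. A letter of public discussion is a block of `k`
symbols of a public alphabet of size `a`. The channel input `U`, of law `pU` on `Fin u`, is
independent of the source `(X, Y, Z)`; the public letter is `F = out U X Y`, formed by one of the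
terminals, i.e. `F` is a function of `(U, X)` or a function of `(U, Y)`. -/
structure ConceptualChannel (X Y : Type*) (k a u : ℕ) where
  /-- law of the channel input -/
  pU : Fin u → ℝ
  pU_mem : pU ∈ stdSimplex ℝ (Fin u)
  /-- the public letter formed from the channel input and the source -/
  out : Fin u → X → Y → (Fin k → Fin a)
  oneSided : (∀ v x y y', out v x y = out v x y') ∨ (∀ v x x' y, out v x y = out v x' y)

section ConceptualChannel

variable {X Y Z : Type*} [Fintype X] [Fintype Y] [Fintype Z] {k a u : ℕ}

/-- The transition probabilities `P_{ZF|U}(z, f | v)` to the warden. -/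
def ConceptualChannel.kernel (W : ConceptualChannel X Y k a u) (P : X × Y × Z → ℝ)
    (v : Fin u) : Z × (Fin k → Fin a) → ℝ :=
  law P (fun s => (s.2.2, W.out v s.1 s.2.1))

/-- The single-letter law `Q_{ZF}` at the warden when the input has law `pU`. -/
def ConceptualChannel.letterLaw (W : ConceptualChannel X Y k a u) (P : X × Y × Z → ℝ)
    (s : Z × (Fin k → Fin a)) : ℝ :=
  ∑ v, W.kernel P v s * W.pU v

/-- A meaningless letter of discussion is independent of the warden's source observation:
`Q_{ZF} = P_Z × Q_F`. -/
def ConceptualChannel.Meaningless (W : ConceptualChannel X Y k a u) (P : X × Y × Z → ℝ) : Prop :=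
  ∀ z f, W.letterLaw P (z, f) =
    law P (fun s => s.2.2) z * law (W.letterLaw P) Prod.snd f

/-- The law of the warden's observation `(Zⁿ, F)` under a meaningless discussion,
`Q_{ZⁿF}(z, f) = ∑_{uⁿ} P_{ZⁿF|Uⁿ}(z, f | uⁿ) P_{Uⁿ}(uⁿ)`, with memoryless channel and
i.i.d. input. -/
def ConceptualChannel.target (W : ConceptualChannel X Y k a u) (P : X × Y × Z → ℝ) (n : ℕ)
    (s : (Fin n → Z) × (Fin n → Fin k → Fin a)) : ℝ :=
  ∑ v : Fin n → Fin u, (∏ i, W.kernel P (v i) (s.1 i, s.2 i)) * ∏ i, W.pU (v i)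

end ConceptualChannel

/-- A source-model key generation protocol with block length `n` and key set `Fin M`. Alice sees
`Xⁿ` and private randomness of law `pA`, Bob sees `Yⁿ` and private randomness of law `pB`. They
exchange `n * k` public symbols; the `t`-th one is sent by Alice if `aliceSpeaks t` and by Bob
otherwise, as a function of the sender's own data and all earlier public symbols. Finally each of
them computes a key from its own data and the whole discussion. -/
structure Protocol (X Y : Type*) (n k a M : ℕ) where
  /-- number of values of Alice's private randomness -/
  randA : ℕ
  /-- number of values of Bob's private randomness -/
  randB : ℕ
  pA : Fin randA → ℝ
  pB : Fin randB → ℝ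
  pA_mem : pA ∈ stdSimplex ℝ (Fin randA)
  pB_mem : pB ∈ stdSimplex ℝ (Fin randB)
  aliceSpeaks : ℕ → Bool
  msgA : (t : ℕ) → (Fin n → X) → Fin randA → (Fin t → Fin a) → Fin a
  msgB : (t : ℕ) → (Fin n → Y) → Fin randB → (Fin t → Fin a) → Fin a
  keyA : (Fin n → X) → Fin randA → (Fin n → Fin k → Fin a) → Fin M
  keyB : (Fin n → Y) → Fin randB → (Fin n → Fin k → Fin a) → Fin M

namespace Protocol

variable {X Y Z : Type*} {n k a M : ℕ}

/-- The `t`-th public symbol. -/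
def symbol (c : Protocol X Y n k a M) (x : Fin n → X) (y : Fin n → Y)
    (ra : Fin c.randA) (rb : Fin c.randB) (t : ℕ) : Fin a :=
  if c.aliceSpeaks t then c.msgA t x ra (fun s : Fin t => c.symbol x y ra rb s)
  else c.msgB t y rb (fun s : Fin t => c.symbol x y ra rb s)
termination_by t
decreasing_by all_goals exact s.isLt

/-- The sample space: source outputs and private randomness. -/
abbrev Sample (Z : Type*) (c : Protocol X Y n k a M) : Type _ :=
  (Fin n → X × Y × Z) × Fin c.randA × Fin c.randB

/-- Probability of a sample: the source is memoryless with law `P`, and the private randomness of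
the two terminals is mutually independent and independent of the source. -/
def prob (c : Protocol X Y n k a M) (P : X × Y × Z → ℝ) (w : c.Sample Z) : ℝ :=
  (∏ i, P (w.1 i)) * (c.pA w.2.1 * c.pB w.2.2)

/-- The public discussion `F`, consisting of `n` letters of `k` symbols each. -/
def discussion (c : Protocol X Y n k a M) (w : c.Sample Z) : Fin n → Fin k → Fin a :=
  fun i j => c.symbol (fun l => (w.1 l).1) (fun l => (w.1 l).2.1) w.2.1 w.2.2 (i * k + j)

/-- Alice's key `K`. -/
def key (c : Protocol X Y n k a M) (w : c.Sample Z) : Fin M :=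
  c.keyA (fun l => (w.1 l).1) w.2.1 (c.discussion w)

/-- Bob's key `K̂`. -/
def keyHat (c : Protocol X Y n k a M) (w : c.Sample Z) : Fin M :=
  c.keyB (fun l => (w.1 l).2.1) w.2.2 (c.discussion w)

/-- The warden's observation `(Zⁿ, F)`. -/
def wardenView (c : Protocol X Y n k a M) (w : c.Sample Z) :
    (Fin n → Z) × (Fin n → Fin k → Fin a) :=
  (fun l => (w.1 l).2.2, c.discussion w)

variable [Fintype X] [Fintype Y] [Fintype Z]

/-- `Pr(K ≠ K̂)`. -/
def errorProb (c : Protocol X Y n k a M) (P : X × Y × Z → ℝ) : ℝ :=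
  ∑ w : c.Sample Z, if c.key w ≠ c.keyHat w then c.prob P w else 0

/-- `log |𝒦| - H(K)`. -/
def nonUniformity (c : Protocol X Y n k a M) (P : X × Y × Z → ℝ) : ℝ :=
  Real.logb 2 M - entropy (law (c.prob P) c.key)

/-- Non-confusion: `D(P_{K Zⁿ F} ‖ P_K P_{Zⁿ F})`. -/
def nonConfusion (c : Protocol X Y n k a M) (P : X × Y × Z → ℝ) : EReal :=
  divergence (law (c.prob P) (fun w => (c.key w, c.wardenView w)))
    (fun s => law (c.prob P) c.key s.1 * law (c.prob P) c.wardenView s.2)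

/-- Non-stealth: `D(P_{Zⁿ F} ‖ Q_{Zⁿ F})`. -/
def nonStealth {u : ℕ} (c : Protocol X Y n k a M) (P : X × Y × Z → ℝ)
    (W : ConceptualChannel X Y k a u) : EReal :=
  divergence (law (c.prob P) c.wardenView) (W.target P n)

end Protocol

variable {X Y Z : Type*} [Fintype X] [Fintype Y] [Fintype Z]

/-- The rate `R` (bits per source symbol) is achievable under the effective secrecy constraint: for
some conceptual wiretap channel, whose output under i.i.d. input is the meaningless discussion,
and for every `ε > 0`, for all large `n` there is a protocol with key set of size `⌈2 ^ (n R)⌉`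
satisfying the reliability, uniformity and effective secrecy constraints with `ε`. -/
def Achievable (P : X × Y × Z → ℝ) (R : ℝ) : Prop :=
  0 ≤ R ∧ ∃ (k a u : ℕ) (W : ConceptualChannel X Y k a u), W.Meaningless P ∧
    ∀ ε : ℝ, 0 < ε → ∀ᶠ n : ℕ in Filter.atTop,
      ∃ c : Protocol X Y n k a ⌈(2 : ℝ) ^ ((n : ℝ) * R)⌉₊,
        c.errorProb P ≤ ε ∧ c.nonUniformity P ≤ ε ∧
          c.nonConfusion P + c.nonStealth P W ≤ (ε : EReal)

/-- The stealthy secret key capacity: supremum of the achievable rates. -/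
def capacity (P : X × Y × Z → ℝ) : EReal :=
  sSup ((fun R : ℝ => (R : EReal)) '' {R | Achievable P R})

end StealthyKey

end

/-! Converse. Conditioned on the public symbols and on a function `ζ` of the warden's source, the
mutual information of the two terminals' data starts at `n` times its single-letter value and never
grows, because each symbol is computed by one terminal from its own data and the past
(`Protocol.residualInfo_succ_le`). The key's entropy is at most its leakage, plus its equivocation
given Bob's key, plus this quantity (`Protocol.entropy_key_le`). Secrecy bounds the first term and
Fano the second. A constant `ζ` gives `I(X;Y)` and the identity gives `I(X;Y|Z)`; stealth enters
only through the nonnegativity of its divergence.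

Achievability. Let the meaningless discussion be fair bits independent of the source. The speaker
hashes the observed sequence at random into a pair (key, public part) and pads the public part with
private fair bits to exactly `n * k` bits. One number, `hashLeakage`, measures how far (key, public
part) is from uniform and independent of `Zⁿ`; it bounds nonuniformity, and confusion and stealth
together (`Protocol.hash_protocol_secrecy`). It vanishes when the total hash rate is below `H(X|Z)`,
while decoding succeeds when the public rate exceeds `H(X|Y)`. Key rates below `H(X|Z) - H(X|Y) =
I(X;Y) - I(X;Z)` are therefore available, and symmetrically when Bob speaks.

Both random-hash estimates are one-shot averages of likelihood ratios raised to a small power. Such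
averages tensorize to `λ ^ n`, and `λ < 1` for a small exponent since the derivative at exponent
zero is negative (`exists_sum_rpow_lt_one`). The exponential decay also pays for the factor `n` in
Fano's inequality. -/

noncomputable section

namespace StealthyKey

/-! ### Laws of random variables on a finite space. -/

section Law

variable {α β γ δ : Type*} [Fintype α]

theorem law_nonneg {p : α → ℝ} (hp : ∀ a, 0 ≤ p a) (g : α → β) (b : β) : 0 ≤ law p g b := by
  unfold law
  exact Finset.sum_nonneg fun a _ => by split_ifs <;> simp [hp]

theorem law_mono {p : α → ℝ} (hp : ∀ a, 0 ≤ p a) {g : α → β} {h : α → γ} {b : β} {c : γ}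
    (H : ∀ a, g a = b → h a = c) : law p g b ≤ law p h c := by
  unfold law
  refine Finset.sum_le_sum fun a _ => ?_
  by_cases h1 : g a = b
  · simp [h1, H a h1]
  · rw [if_neg h1]; split_ifs; exacts [hp a, le_rfl]

theorem law_congr {p : α → ℝ} {g : α → β} {h : α → γ} {b : β} {c : γ}
    (H : ∀ a, g a = b ↔ h a = c) : law p g b = law p h c := by
  unfold law
  exact Finset.sum_congr rfl fun a _ => by
    by_cases h : g a = b
    · rw [if_pos h, if_pos ((H a).1 h)]
    · rw [if_neg h, if_neg (mt (H a).2 h)]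

theorem le_law {p : α → ℝ} (hp : ∀ a, 0 ≤ p a) (g : α → β) (a : α) : p a ≤ law p g (g a) := by
  classical
  unfold law
  refine le_trans (by simp) (Finset.single_le_sum (f := fun x => if g x = g a then p x else 0)
    (fun x _ => by split_ifs <;> simp [hp]) (Finset.mem_univ a))

theorem law_pos {p : α → ℝ} (hp : ∀ a, 0 ≤ p a) (g : α → β) {a : α} (ha : p a ≠ 0) :
    0 < law p g (g a) :=
  lt_of_lt_of_le (lt_of_le_of_ne (hp a) ha.symm) (le_law hp g a)

theorem sum_law_mul [Fintype β] (p : α → ℝ) (g : α → β) (φ : β → ℝ) :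
    ∑ b, law p g b * φ b = ∑ a, p a * φ (g a) := by
  classical
  unfold law
  simp_rw [Finset.sum_mul]
  rw [Finset.sum_comm]
  refine Finset.sum_congr rfl fun a _ => ?_
  simp [ite_mul]

theorem sum_law [Fintype β] (p : α → ℝ) (g : α → β) : ∑ b, law p g b = ∑ a, p a := by
  simpa using sum_law_mul p g (fun _ => 1)

theorem law_mem [Fintype β] {p : α → ℝ} (hp : p ∈ stdSimplex ℝ α) (g : α → β) :
    law p g ∈ stdSimplex ℝ β :=
  ⟨law_nonneg hp.1 g, by rw [sum_law]; exact hp.2⟩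

theorem law_law [Fintype β] (p : α → ℝ) (g : α → β) (h : β → γ) :
    law (law p g) h = law p (fun a => h (g a)) := by
  classical
  funext c
  have := sum_law_mul p g (fun b => if h b = c then 1 else 0)
  simp only [mul_ite, mul_one, mul_zero] at this
  unfold law at this ⊢
  convert this

theorem law_equiv (p : α → ℝ) (e : α ≃ β) (b : β) : law p e b = p (e.symm b) := by
  classical
  unfold law
  simp [← Equiv.eq_symm_apply]

theorem law_id (p : α → ℝ) : law p (fun a => a) = p :=
  funext fun b => law_equiv p (Equiv.refl α) b

theorem sum_law_pair [Fintype β] (p : α → ℝ) (f : α → β) (g : α → γ) (v : γ) :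
    ∑ u, law p (fun a => (f a, g a)) (u, v) = law p g v := by
  classical
  unfold law
  rw [Finset.sum_comm]
  refine Finset.sum_congr rfl fun a _ => ?_
  by_cases h : g a = v <;> simp [h]

end Law

/-- Termwise `log x ≥ 1 - 1/x`, then summation. Only the total masses are compared, so `q` may be a
subprobability, as in the proof of Fano's inequality. -/
theorem gibbs_inequality {ι : Type*} [Fintype ι] {p q : ι → ℝ} (hp : ∀ i, 0 ≤ p i)
    (hq : ∀ i, 0 ≤ q i) (hac : ∀ i, q i = 0 → p i = 0) (hle : ∑ i, q i ≤ ∑ i, p i) :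
    0 ≤ ∑ i, p i * Real.logb 2 (p i / q i) := by
  have key : ∀ i, (p i - q i) / Real.log 2 ≤ p i * Real.logb 2 (p i / q i) := by
    intro i
    have h2 : 0 < Real.log 2 := Real.log_pos one_lt_two
    rw [Real.logb, ← mul_div_assoc]
    refine div_le_div_of_nonneg_right ?_ h2.le
    rcases (hp i).eq_or_lt with h | h
    · simp [← h, hq i]
    · have hqi : 0 < q i := lt_of_le_of_ne (hq i) fun h' => h.ne' (hac i h'.symm)
      have := Real.one_sub_inv_le_log_of_pos (div_pos h hqi)
      calc p i - q i = p i * (1 - (p i / q i)⁻¹) := by field_simp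
        _ ≤ _ := mul_le_mul_of_nonneg_left this h.le
  refine le_trans ?_ (Finset.sum_le_sum fun i _ => key i)
  rw [← Finset.sum_div, Finset.sum_sub_distrib]
  exact div_nonneg (by linarith) (Real.log_nonneg one_le_two)

/-- Entropy (in bits) of a random variable on a finite probability space. -/
def rvEntropy {α β : Type*} [Fintype α] [Fintype β] (p : α → ℝ) (g : α → β) : ℝ :=
  entropy (law p g)

/-! ### Entropy inequalities: monotonicity, submodularity, Fano. -/

section Entropy

variable {α β γ δ ε : Type*} [Fintype α] [Fintype β] [Fintype γ] [Fintype δ] [Fintype ε]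

theorem rvEntropy_eq (p : α → ℝ) (g : α → β) :
    rvEntropy p g = -∑ a, p a * Real.logb 2 (law p g (g a)) := by
  rw [rvEntropy, entropy, Finset.sum_neg_distrib,
    sum_law_mul p g (fun b => Real.logb 2 (law p g b))]

theorem rvEntropy_law (p : α → ℝ) (g : α → β) (h : β → γ) :
    rvEntropy (law p g) h = rvEntropy p (fun a => h (g a)) := by
  rw [rvEntropy, rvEntropy, law_law]

/-- A coarser variable has larger fibres; with both entropies written as sums over the sample space,
the comparison is pointwise. -/
theorem rvEntropy_mono {p : α → ℝ} (hp : ∀ a, 0 ≤ p a) {g : α → β} {h : α → γ}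
    (H : ∀ a b, h a = h b → g a = g b) : rvEntropy p g ≤ rvEntropy p h := by
  rw [rvEntropy_eq, rvEntropy_eq, neg_le_neg_iff]
  refine Finset.sum_le_sum fun a _ => ?_
  by_cases ha : p a = 0
  · simp [ha]
  · exact mul_le_mul_of_nonneg_left (Real.logb_le_logb_of_le one_lt_two (law_pos hp h ha)
      (law_mono hp fun b hb => H b a hb)) (hp a)

theorem rvEntropy_congr {p : α → ℝ} {g : α → β} {h : α → γ}
    (H : ∀ a b, g a = g b ↔ h a = h b) : rvEntropy p g = rvEntropy p h := by
  rw [rvEntropy_eq, rvEntropy_eq]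
  congr 1
  exact Finset.sum_congr rfl fun a _ => by rw [law_congr fun b => H b a]

theorem mutualInfo_law {p : α → ℝ} (hp : ∀ a, 0 ≤ p a) (f : α → β) (g : α → γ) :
    mutualInfo (law p (fun a => (f a, g a))) =
      rvEntropy p f + rvEntropy p g - rvEntropy p (fun a => (f a, g a)) := by
  rw [mutualInfo, sum_law_mul p (fun a => (f a, g a)), law_law, law_law, rvEntropy_eq,
    rvEntropy_eq, rvEntropy_eq, sub_neg_eq_add, ← neg_add, neg_add_eq_sub,
    ← Finset.sum_add_distrib, ← Finset.sum_sub_distrib]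
  refine Finset.sum_congr rfl fun a _ => ?_
  by_cases ha : p a = 0
  · simp [ha]
  · have h1 := (law_pos hp f ha).ne'
    have h2 := (law_pos hp g ha).ne'
    have h3 := (law_pos hp (fun a => (f a, g a)) ha).ne'
    rw [Real.logb_div h3 (mul_ne_zero h1 h2), Real.logb_mul h1 h2]
    ring

theorem condMutualInfo_law {p : α → ℝ} (hp : ∀ a, 0 ≤ p a) (f : α → β) (g : α → γ) (h : α → δ) :
    condMutualInfo (law p (fun a => (f a, g a, h a))) =
      rvEntropy p (fun a => (f a, h a)) + rvEntropy p (fun a => (g a, h a)) -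
        rvEntropy p (fun a => (f a, g a, h a)) - rvEntropy p h := by
  rw [condMutualInfo, sum_law_mul p (fun a => (f a, g a, h a)), law_law, law_law, law_law,
    rvEntropy_eq, rvEntropy_eq, rvEntropy_eq, rvEntropy_eq, sub_neg_eq_add, sub_neg_eq_add,
    ← neg_add, neg_add_eq_sub, sub_add_eq_add_sub,
    ← Finset.sum_add_distrib, ← Finset.sum_add_distrib, ← Finset.sum_sub_distrib]
  refine Finset.sum_congr rfl fun a _ => ?_
  by_cases ha : p a = 0
  · simp [ha]
  · have h1 := (law_pos hp (fun a => (f a, h a)) ha).ne'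
    have h2 := (law_pos hp (fun a => (g a, h a)) ha).ne'
    have h3 := (law_pos hp (fun a => (f a, g a, h a)) ha).ne'
    have h4 := (law_pos hp h ha).ne'
    rw [Real.logb_div (mul_ne_zero h4 h3) (mul_ne_zero h1 h2), Real.logb_mul h1 h2,
      Real.logb_mul h4 h3]
    ring

/-- Gibbs' inequality against the conditionally independent coupling `P_{AC} P_{BC} / P_C`, which
has the same total mass. -/
theorem condMutualInfo_law_nonneg {p : α → ℝ} (hp : ∀ a, 0 ≤ p a) (f : α → β) (g : α → γ)
    (h : α → δ) : 0 ≤ condMutualInfo (law p (fun a => (f a, g a, h a))) := by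
  set q := law p (fun a => (f a, g a, h a)) with hq
  have hq0 : ∀ s, 0 ≤ q s := law_nonneg hp _
  set F := law q (fun t => (t.1, t.2.2))
  set G := law q (fun t => t.2)
  set C := law q (fun t => t.2.2)
  have hF : ∀ s, 0 ≤ F s := law_nonneg hq0 _
  have hG : ∀ s, 0 ≤ G s := law_nonneg hq0 _
  have hC : ∀ s, 0 ≤ C s := law_nonneg hq0 _
  have key := gibbs_inequality (p := q) (q := fun s => F (s.1, s.2.2) * G s.2 / C s.2.2) hq0
    (fun s => div_nonneg (mul_nonneg (hF _) (hG _)) (hC _)) ?_ ?_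
  · refine key.trans_eq ?_
    unfold condMutualInfo
    refine Finset.sum_congr rfl fun s _ => ?_
    rw [div_div_eq_mul_div, mul_comm (q s) (law _ _ _)]
  · intro s hs
    by_contra h0
    have h1 := law_pos hq0 (fun t => (t.1, t.2.2)) h0
    have h2 := law_pos hq0 (fun t => t.2) h0
    have h3 := law_pos hq0 (fun t => t.2.2) h0
    exact (div_pos (mul_pos h1 h2) h3).ne' hs
  · have e1 : ∀ w, ∑ u, F (u, w) = C w := fun w => sum_law_pair q (fun t => t.1) (fun t => t.2.2) w
    have e2 : ∀ w, ∑ v, G (v, w) = C w := fun w =>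
      sum_law_pair q (fun t => t.2.1) (fun t => t.2.2) w
    calc ∑ s : β × γ × δ, F (s.1, s.2.2) * G s.2 / C s.2.2
        = ∑ w, ∑ v, ∑ u, F (u, w) * G (v, w) / C w := by
          rw [Fintype.sum_prod_type_right, Fintype.sum_prod_type_right]
      _ = ∑ w, C w * C w / C w := by
          refine Finset.sum_congr rfl fun w _ => ?_
          simp_rw [← Finset.sum_div, ← Finset.sum_mul, ← Finset.mul_sum, e1, e2]
      _ = ∑ w, C w := Finset.sum_congr rfl fun w _ => by
          by_cases h : C w = 0 <;> simp [h]
      _ = ∑ s, q s := sum_law _ _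
      _ ≤ _ := le_rfl

/-- Submodularity of entropy: if `f₁` and `f₂` together determine `f₁₂`, and each of them
determines `f₀`, then `H(f₁₂) + H(f₀) ≤ H(f₁) + H(f₂)`. -/
theorem rvEntropy_submodular {p : α → ℝ} (hp : ∀ a, 0 ≤ p a) {f₁ : α → β} {f₂ : α → γ}
    {f₁₂ : α → δ} {f₀ : α → ε} (h12 : ∀ a b, f₁ a = f₁ b → f₂ a = f₂ b → f₁₂ a = f₁₂ b)
    (h1 : ∀ a b, f₁ a = f₁ b → f₀ a = f₀ b) (h2 : ∀ a b, f₂ a = f₂ b → f₀ a = f₀ b) :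
    rvEntropy p f₁₂ + rvEntropy p f₀ ≤ rvEntropy p f₁ + rvEntropy p f₂ := by
  -- This is `I(f₁; f₂ | f₀) ≥ 0`. The variable `f₀` can be dropped from the pairs containing `f₁`
  -- or `f₂`, each of which determines it.
  have h := condMutualInfo_law_nonneg hp f₁ f₂ f₀
  rw [condMutualInfo_law hp] at h
  have e1 : rvEntropy p (fun a => (f₁ a, f₀ a)) = rvEntropy p f₁ :=
    rvEntropy_congr fun a b => by simpa using h1 a b
  have e2 : rvEntropy p (fun a => (f₂ a, f₀ a)) = rvEntropy p f₂ :=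
    rvEntropy_congr fun a b => by simpa using h2 a b
  have e3 : rvEntropy p f₁₂ ≤ rvEntropy p (fun a => (f₁ a, f₂ a, f₀ a)) :=
    rvEntropy_mono hp fun a b => by
      simp only [Prod.mk.injEq]; exact fun h => h12 a b h.1 h.2.1
  linarith

theorem rvEntropy_const {p : α → ℝ} (hp : p ∈ stdSimplex ℝ α) {g : α → β}
    (H : ∀ a b, g a = g b) : rvEntropy p g = 0 := by
  rw [rvEntropy_eq]
  have : ∀ a, law p g (g a) = 1 := fun a => by
    rw [← hp.2, law]; exact Finset.sum_congr rfl fun b _ => by simp [H b a]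
  simp [this]

theorem rvEntropy_le_logb_card {p : α → ℝ} (hp : p ∈ stdSimplex ℝ α) (g : α → β) :
    rvEntropy p g ≤ Real.logb 2 (Fintype.card β) := by
  have hl := law_mem hp g
  have hne : Nonempty β := by
    by_contra h
    rw [not_nonempty_iff] at h
    simpa using hl.2
  have hc : (0 : ℝ) < Fintype.card β := by exact_mod_cast Fintype.card_pos
  have := gibbs_inequality (p := law p g) (q := fun _ => (Fintype.card β : ℝ)⁻¹) hl.1
    (fun _ => by positivity) (fun _ h => absurd h (by positivity))
    (by rw [hl.2]; simp [hc.ne'])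
  have e : ∀ b, law p g b * Real.logb 2 (law p g b / (Fintype.card β : ℝ)⁻¹) =
      law p g b * Real.logb 2 (Fintype.card β) - -(law p g b * Real.logb 2 (law p g b)) := by
    intro b
    by_cases h : law p g b = 0
    · simp [h]
    · rw [div_inv_eq_mul, Real.logb_mul h hc.ne']; ring
  simp_rw [e] at this
  rw [Finset.sum_sub_distrib, ← Finset.sum_mul, hl.2, one_mul] at this
  unfold rvEntropy entropy
  linarith

/-- Fano's inequality, with a free parameter `e` in place of the error probability inside the
binary entropy. -/
theorem rvEntropy_fano [DecidableEq β] {p : α → ℝ} (hp : p ∈ stdSimplex ℝ α) (f g : α → β)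
    {e : ℝ} (he : 0 < e) (he1 : e < 1) :
    rvEntropy p (fun a => (f a, g a)) - rvEntropy p g ≤
      -Real.logb 2 (1 - e) +
        (∑ a, if f a ≠ g a then p a else 0) *
          (Real.logb 2 (1 / e) + Real.logb 2 (Fintype.card β)) := by
  classical
  set M : ℝ := (Fintype.card β : ℝ) with hM
  have hne : Nonempty β := by
    by_contra h
    rw [not_nonempty_iff] at h
    have : IsEmpty α := ⟨fun a => h.elim (f a)⟩
    simpa using hp.2
  have hM0 : 0 < M := by rw [hM]; exact_mod_cast Fintype.card_pos
  have hM1 : 1 ≤ M := by rw [hM]; exact_mod_cast Fintype.card_pos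
  set L := law p (fun a => (f a, g a)) with hL
  have hLm : L ∈ stdSimplex ℝ (β × β) := law_mem hp _
  -- A guessed reverse channel: agreement gets `1 - e`, every other symbol `e / M`. Each column has
  -- mass at most one, so Gibbs' inequality applies to `P_g · w`.
  set w : β → β → ℝ := fun u v => if u = v then 1 - e else e / M with hw
  have hw0 : ∀ u v, 0 < w u v := fun u v => by
    simp only [hw]; split_ifs
    · linarith
    · positivity
  have key := gibbs_inequality (p := L) (q := fun s => law p g s.2 * w s.1 s.2) hLm.1
    (fun s => mul_nonneg (law_nonneg hp.1 _ _) (hw0 _ _).le) ?_ ?_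
  · rw [hL, sum_law_mul p (fun a => (f a, g a))
      (fun s => Real.logb 2 (law p (fun a => (f a, g a)) s / (law p g s.2 * w s.1 s.2)))] at key
    have e1 : ∀ a, p a * Real.logb 2 (law p (fun a => (f a, g a)) (f a, g a) /
        (law p g (g a) * w (f a) (g a))) =
        p a * Real.logb 2 (law p (fun a => (f a, g a)) (f a, g a)) -
          p a * Real.logb 2 (law p g (g a)) - p a * Real.logb 2 (w (f a) (g a)) := by
      intro a
      by_cases ha : p a = 0
      · simp [ha]
      · have h1 := (law_pos hp.1 (fun a => (f a, g a)) ha).ne'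
        have h2 := (law_pos hp.1 g ha).ne'
        rw [Real.logb_div h1 (mul_ne_zero h2 (hw0 _ _).ne'), Real.logb_mul h2 (hw0 _ _).ne']
        ring
    have e2 : ∀ a, -(p a * Real.logb 2 (w (f a) (g a))) ≤ p a * -Real.logb 2 (1 - e) +
        (if f a ≠ g a then p a else 0) * (Real.logb 2 (1 / e) + Real.logb 2 M) := by
      intro a
      have h1 : Real.logb 2 (1 - e) ≤ 0 :=
        Real.logb_nonpos one_lt_two (by linarith) (by linarith)
      simp only [hw]
      by_cases h : f a = g a
      · simp [h]
      · rw [if_neg h, if_pos h, ← Real.logb_mul (by positivity) hM0.ne', ← mul_neg,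
          ← Real.logb_inv, inv_div, one_div_mul_eq_div]
        have := mul_nonpos_of_nonneg_of_nonpos (hp.1 a) h1
        linarith
    simp only [e1, Finset.sum_sub_distrib] at key
    have e3 := Finset.sum_le_sum fun a (_ : a ∈ Finset.univ) => e2 a
    rw [Finset.sum_neg_distrib, Finset.sum_add_distrib, ← Finset.sum_mul, ← Finset.sum_mul, hp.2,
      one_mul] at e3
    rw [rvEntropy_eq, rvEntropy_eq]
    linarith
  · intro s hs
    have hs' : law p g s.2 = 0 := (mul_eq_zero.1 hs).resolve_right (hw0 _ _).ne'
    exact le_antisymm (hs' ▸ law_mono hp.1 (fun a ha => by rw [← ha])) (hLm.1 s)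
  · rw [hLm.2, Fintype.sum_prod_type_right]
    calc ∑ v, ∑ u, law p g v * w u v ≤ ∑ v, law p g v * 1 := by
          refine Finset.sum_le_sum fun v _ => ?_
          rw [← Finset.mul_sum]
          refine mul_le_mul_of_nonneg_left ?_ (law_nonneg hp.1 _ _)
          calc ∑ u, w u v ≤ ∑ u, ((if u = v then 1 - e else 0) + e / M) := by
                refine Finset.sum_le_sum fun u _ => ?_
                simp only [hw]
                split_ifs
                · have : 0 ≤ e / M := by positivity
                  linarith
                · simp
            _ = 1 := by
                rw [Finset.sum_add_distrib]
                simp [← hM]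
                field_simp
                ring
      _ = 1 := by simp_rw [mul_one]; exact (sum_law _ _).trans hp.2

end Entropy

/-! ### Independent products and i.i.d. sequences. -/

section Product

variable {α β γ δ S : Type*} [Fintype S]

theorem sum_pi_prod {n : ℕ} (f : Fin n → S → ℝ) :
    ∑ w : Fin n → S, ∏ i, f i (w i) = ∏ i, ∑ s, f i s := by
  classical
  rw [Finset.prod_univ_sum, Fintype.piFinset_univ]

/-- The law of `n` independent copies of a random variable of law `P`. -/
def iid {S : Type*} (P : S → ℝ) (n : ℕ) (w : Fin n → S) : ℝ := ∏ i, P (w i)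

theorem iid_mem {P : S → ℝ} (hP : P ∈ stdSimplex ℝ S) (n : ℕ) :
    iid P n ∈ stdSimplex ℝ (Fin n → S) :=
  ⟨fun w => Finset.prod_nonneg fun i _ => hP.1 (w i), by
    unfold iid; rw [sum_pi_prod (fun _ => P)]; simp [hP.2]⟩

theorem sum_iid_mul {P : S → ℝ} (hP : P ∈ stdSimplex ℝ S) {n : ℕ} (j : Fin n) (φ : S → ℝ) :
    ∑ w, iid P n w * φ (w j) = ∑ s, P s * φ s := by
  classical
  have h : ∀ w : Fin n → S, iid P n w * φ (w j) =
      ∏ i, (fun i s => P s * if i = j then φ s else 1) i (w i) := by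
    intro w
    simp only [iid, Finset.prod_mul_distrib]
    congr 1
    simp
  refine (Finset.sum_congr rfl fun w _ => h w).trans
    ((sum_pi_prod (fun i s => P s * if i = j then φ s else 1)).trans ?_)
  rw [Finset.prod_eq_single j]
  · simp
  · intro i _ hi; simp [hi, hP.2]
  · simp

theorem law_iid (P : S → ℝ) (n : ℕ) (g : S → α) :
    law (iid P n) (fun w i => g (w i)) = iid (law P g) n := by
  classical
  funext c
  unfold iid law
  rw [← sum_pi_prod (fun i s => if g s = c i then P s else 0)]
  refine Finset.sum_congr rfl fun w _ => ?_
  by_cases h : (fun i => g (w i)) = c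
  · rw [if_pos h]
    exact Finset.prod_congr rfl fun i _ => by rw [if_pos (congrFun h i)]
  · rw [if_neg h]
    obtain ⟨i, hi⟩ := Function.ne_iff.1 h
    exact (Finset.prod_eq_zero (Finset.mem_univ i) (if_neg hi)).symm

theorem rvEntropy_iid [Fintype α] {P : S → ℝ} (hP : P ∈ stdSimplex ℝ S) (n : ℕ) (g : S → α) :
    rvEntropy (iid P n) (fun w i => g (w i)) = n * rvEntropy P g := by
  have key : ∀ w, iid P n w * Real.logb 2 (iid (law P g) n fun i => g (w i)) =
      ∑ j, iid P n w * Real.logb 2 (law P g (g (w j))) := by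
    intro w
    by_cases h : iid P n w = 0
    · simp [h]
    · rw [← Finset.mul_sum, iid, iid, Real.logb_prod]
      intro i hi
      exact (law_pos hP.1 g (Finset.prod_ne_zero_iff.1 h i hi)).ne'
  rw [rvEntropy_eq, rvEntropy_eq, law_iid]
  simp_rw [key]
  rw [Finset.sum_comm]
  simp_rw [fun j => sum_iid_mul hP (n := n) j (fun s => Real.logb 2 (law P g (g s)))]
  simp

variable [Fintype α] [Fintype β]

/-- The law of an independent pair. -/
def prodLaw {α β : Type*} (p : α → ℝ) (q : β → ℝ) (s : α × β) : ℝ := p s.1 * q s.2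

theorem prodLaw_mem {p : α → ℝ} {q : β → ℝ} (hp : p ∈ stdSimplex ℝ α) (hq : q ∈ stdSimplex ℝ β) :
    prodLaw p q ∈ stdSimplex ℝ (α × β) :=
  ⟨fun s => mul_nonneg (hp.1 _) (hq.1 _), by
    unfold prodLaw
    rw [Fintype.sum_prod_type]
    simp_rw [← Finset.mul_sum, hq.2, mul_one]
    exact hp.2⟩

theorem law_prodLaw (p : α → ℝ) (q : β → ℝ) (f : α → γ) (g : β → δ) :
    law (prodLaw p q) (fun s => (f s.1, g s.2)) = prodLaw (law p f) (law q g) := by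
  classical
  funext s
  unfold prodLaw law
  rw [Fintype.sum_prod_type, Finset.sum_mul_sum]
  refine Finset.sum_congr rfl fun a _ => Finset.sum_congr rfl fun b _ => ?_
  rw [Prod.ext_iff]
  by_cases h1 : f a = s.1 <;> by_cases h2 : g b = s.2 <;> simp [h1, h2]

theorem law_prodLaw_fst (p : α → ℝ) {q : β → ℝ} (hq : ∑ b, q b = 1) (f : α → γ) :
    law (prodLaw p q) (fun s => f s.1) = law p f := by
  classical
  funext s
  unfold prodLaw law
  rw [Fintype.sum_prod_type]
  refine Finset.sum_congr rfl fun a _ => ?_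
  by_cases h1 : f a = s <;> simp [h1, ← Finset.mul_sum, hq]

theorem law_prodLaw_snd {p : α → ℝ} (hp : ∑ a, p a = 1) (q : β → ℝ) (g : β → γ) :
    law (prodLaw p q) (fun s => g s.2) = law q g := by
  classical
  funext s
  unfold prodLaw law
  rw [Fintype.sum_prod_type_right]
  refine Finset.sum_congr rfl fun a _ => ?_
  by_cases h1 : g a = s <;> simp [h1, ← Finset.sum_mul, hp]

theorem rvEntropy_prodLaw [Fintype γ] [Fintype δ] {p : α → ℝ} {q : β → ℝ} (hp : p ∈ stdSimplex ℝ α)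
    (hq : q ∈ stdSimplex ℝ β) (f : α → γ) (g : β → δ) :
    rvEntropy (prodLaw p q) (fun s => (f s.1, g s.2)) = rvEntropy p f + rvEntropy q g := by
  have e1 : rvEntropy p f = rvEntropy (prodLaw p q) (fun s => f s.1) := by
    rw [rvEntropy, rvEntropy, law_prodLaw_fst p hq.2]
  have e2 : rvEntropy q g = rvEntropy (prodLaw p q) (fun s => g s.2) := by
    rw [rvEntropy, rvEntropy, law_prodLaw_snd hp.2]
  rw [e1, e2, rvEntropy_eq, rvEntropy_eq, rvEntropy_eq, ← neg_add, ← Finset.sum_add_distrib]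
  congr 1
  refine Finset.sum_congr rfl fun s _ => ?_
  by_cases h : prodLaw p q s = 0
  · simp [h]
  · have h1 := (law_pos hp.1 f (left_ne_zero_of_mul h)).ne'
    have h2 := (law_pos hq.1 g (right_ne_zero_of_mul h)).ne'
    rw [law_prodLaw, law_prodLaw_fst p hq.2, law_prodLaw_snd hp.2, ← mul_add]
    simp only [prodLaw]
    rw [Real.logb_mul h1 h2]

end Product

/-! ### Divergence expressed through entropies. -/

section Divergence

variable {α β γ : Type*} [Fintype α] [Fintype β] [Fintype γ]

/-- The product of the marginals dominates the joint law, so the divergence is finite and secrecy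
can be handled by real arithmetic. -/
theorem divergence_joint {p : α → ℝ} (hp : ∀ a, 0 ≤ p a) (f : α → β) (g : α → γ) :
    divergence (law p (fun a => (f a, g a))) (fun s => law p f s.1 * law p g s.2) =
      ((rvEntropy p f + rvEntropy p g - rvEntropy p (fun a => (f a, g a)) : ℝ) : EReal) := by
  rw [divergence, if_pos, ← mutualInfo_law hp, mutualInfo, law_law, law_law]
  intro s hs
  rcases mul_eq_zero.1 hs with h | h
  · exact le_antisymm (h ▸ law_mono hp fun a ha => by rw [← ha]) (law_nonneg hp _ _)
  · exact le_antisymm (h ▸ law_mono hp fun a ha => by rw [← ha]) (law_nonneg hp _ _)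

theorem divergence_nonneg {p q : α → ℝ} (hp : p ∈ stdSimplex ℝ α) (hq : q ∈ stdSimplex ℝ α) :
    0 ≤ divergence p q := by
  unfold divergence
  split_ifs with h
  · exact_mod_cast gibbs_inequality hp.1 hq.1 h (by rw [hp.2, hq.2])
  · exact le_top

end Divergence

/-! ### The warden's law under meaningless discussion. -/

namespace ConceptualChannel

variable {X Y Z : Type*} [Fintype X] [Fintype Y] [Fintype Z] {k a u : ℕ}

theorem letterLaw_mem (W : ConceptualChannel X Y k a u) {P : X × Y × Z → ℝ}
    (hP : P ∈ stdSimplex ℝ (X × Y × Z)) :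
    W.letterLaw P ∈ stdSimplex ℝ (Z × (Fin k → Fin a)) := by
  refine ⟨fun s => Finset.sum_nonneg fun v _ =>
    mul_nonneg (law_nonneg hP.1 _ _) (W.pU_mem.1 v), ?_⟩
  unfold letterLaw
  rw [Finset.sum_comm]
  simp_rw [← Finset.sum_mul, kernel, sum_law, hP.2, one_mul]
  exact W.pU_mem.2

/-- Distributing the product over the sum of input sequences shows that the reference law is
memoryless. -/
theorem target_eq (W : ConceptualChannel X Y k a u) (P : X × Y × Z → ℝ) (n : ℕ)
    (s : (Fin n → Z) × (Fin n → Fin k → Fin a)) :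
    W.target P n s = ∏ i, W.letterLaw P (s.1 i, s.2 i) := by
  unfold target letterLaw
  rw [← sum_pi_prod (fun i v => W.kernel P v (s.1 i, s.2 i) * W.pU v)]
  simp_rw [Finset.prod_mul_distrib]

theorem target_mem (W : ConceptualChannel X Y k a u) {P : X × Y × Z → ℝ}
    (hP : P ∈ stdSimplex ℝ (X × Y × Z)) (n : ℕ) :
    W.target P n ∈ stdSimplex ℝ ((Fin n → Z) × (Fin n → Fin k → Fin a)) := by
  have hl := W.letterLaw_mem hP
  refine ⟨fun s => by rw [target_eq]; exact Finset.prod_nonneg fun i _ => hl.1 _, ?_⟩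
  simp_rw [target_eq]
  rw [← (Equiv.arrowProdEquivProdArrow (Fin n) (fun _ => Z) (fun _ => Fin k → Fin a)).sum_comp]
  exact (iid_mem hl n).2

end ConceptualChannel

/-! ### Information flow through a public discussion. -/

namespace Protocol

variable {X Y Z : Type*} {n k a M : ℕ}

/-- The first `t` public symbols. -/
def symbols (c : Protocol X Y n k a M) (t : ℕ) (w : c.Sample Z) (s : Fin t) : Fin a :=
  c.symbol (fun l => (w.1 l).1) (fun l => (w.1 l).2.1) w.2.1 w.2.2 s

theorem symbols_succ_eq_iff (c : Protocol X Y n k a M) (t : ℕ) (v w : c.Sample Z) :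
    c.symbols (t + 1) v = c.symbols (t + 1) w ↔ c.symbols t v = c.symbols t w ∧
      c.symbol (fun l => (v.1 l).1) (fun l => (v.1 l).2.1) v.2.1 v.2.2 t =
        c.symbol (fun l => (w.1 l).1) (fun l => (w.1 l).2.1) w.2.1 w.2.2 t := by
  simp [funext_iff, symbols, Fin.forall_fin_succ']

theorem discussion_eq_iff (c : Protocol X Y n k a M) (v w : c.Sample Z) :
    c.discussion v = c.discussion w ↔ c.symbols (n * k) v = c.symbols (n * k) w := by
  simp only [funext_iff, symbols, discussion]
  rw [← finProdFinEquiv.forall_congr_right, Prod.forall]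
  simp [finProdFinEquiv, add_comm, mul_comm]

/-- Alice's data: source sequence and private randomness. -/
def dataA (c : Protocol X Y n k a M) (w : c.Sample Z) : (Fin n → X) × Fin c.randA :=
  (fun l => (w.1 l).1, w.2.1)

/-- Bob's data: source sequence and private randomness. -/
def dataB (c : Protocol X Y n k a M) (w : c.Sample Z) : (Fin n → Y) × Fin c.randB :=
  (fun l => (w.1 l).2.1, w.2.2)

theorem symbol_congr_alice (c : Protocol X Y n k a M) {t : ℕ} (ht : c.aliceSpeaks t = true)
    {v w : c.Sample Z} (hA : c.dataA v = c.dataA w) (hS : c.symbols t v = c.symbols t w) :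
    c.symbol (fun l => (v.1 l).1) (fun l => (v.1 l).2.1) v.2.1 v.2.2 t =
      c.symbol (fun l => (w.1 l).1) (fun l => (w.1 l).2.1) w.2.1 w.2.2 t := by
  rw [symbol, symbol, if_pos ht, if_pos ht]
  simp only [dataA, Prod.mk.injEq] at hA
  rw [hA.1, hA.2]
  have hS' := hS
  unfold symbols at hS'
  rw [hA.1, hA.2] at hS'
  rw [hS']

theorem symbol_congr_bob (c : Protocol X Y n k a M) {t : ℕ} (ht : ¬c.aliceSpeaks t = true)
    {v w : c.Sample Z} (hB : c.dataB v = c.dataB w) (hS : c.symbols t v = c.symbols t w) :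
    c.symbol (fun l => (v.1 l).1) (fun l => (v.1 l).2.1) v.2.1 v.2.2 t =
      c.symbol (fun l => (w.1 l).1) (fun l => (w.1 l).2.1) w.2.1 w.2.2 t := by
  rw [symbol, symbol, if_neg ht, if_neg ht]
  simp only [dataB, Prod.mk.injEq] at hB
  rw [hB.1, hB.2]
  have hS' := hS
  unfold symbols at hS'
  rw [hB.1, hB.2] at hS'
  rw [hS']

theorem key_congr (c : Protocol X Y n k a M) {v w : c.Sample Z} (hA : c.dataA v = c.dataA w)
    (hF : c.discussion v = c.discussion w) : c.key v = c.key w := by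
  simp only [dataA, Prod.mk.injEq] at hA
  rw [key, key, hA.1, hA.2, hF]

theorem keyHat_congr (c : Protocol X Y n k a M) {v w : c.Sample Z} (hB : c.dataB v = c.dataB w)
    (hF : c.discussion v = c.discussion w) : c.keyHat v = c.keyHat w := by
  simp only [dataB, Prod.mk.injEq] at hB
  rw [keyHat, keyHat, hB.1, hB.2, hF]

theorem prob_eq (c : Protocol X Y n k a M) (P : X × Y × Z → ℝ) :
    (c.prob P : c.Sample Z → ℝ) = prodLaw (iid P n) (prodLaw c.pA c.pB) := rfl

variable [Fintype X] [Fintype Y] [Fintype Z]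

theorem prob_mem (c : Protocol X Y n k a M) {P : X × Y × Z → ℝ}
    (hP : P ∈ stdSimplex ℝ (X × Y × Z)) : c.prob P ∈ stdSimplex ℝ (c.Sample Z) :=
  prodLaw_mem (iid_mem hP n) (prodLaw_mem c.pA_mem c.pB_mem)

variable {Z' : Type*} [Fintype Z']

/-- `I(A; B | F₁ … Fₜ, Z'ⁿ)` for the data `A`, `B` of the terminals. -/
def residualInfo (c : Protocol X Y n k a M) (P : X × Y × Z → ℝ) (ζ : Z → Z') (t : ℕ) : ℝ :=
  rvEntropy (c.prob P) (fun w => (c.dataA w, c.symbols t w, fun l => ζ (w.1 l).2.2)) +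
    rvEntropy (c.prob P) (fun w => (c.dataB w, c.symbols t w, fun l => ζ (w.1 l).2.2)) -
    rvEntropy (c.prob P) (fun w => (c.dataA w, c.dataB w, c.symbols t w, fun l => ζ (w.1 l).2.2)) -
    rvEntropy (c.prob P) (fun w => (c.symbols t w, fun l => ζ (w.1 l).2.2))

/-- Public discussion does not increase the conditional mutual information of the terminals. -/
theorem residualInfo_succ_le (c : Protocol X Y n k a M) {P : X × Y × Z → ℝ}
    (hP : P ∈ stdSimplex ℝ (X × Y × Z)) (ζ : Z → Z') (t : ℕ) :
    c.residualInfo P ζ (t + 1) ≤ c.residualInfo P ζ t := by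
  have hp := (c.prob_mem hP).1
  have hsucc := c.symbols_succ_eq_iff (Z := Z) t
  unfold residualInfo
  -- The speaker's data and the past determine the new symbol, so the entropies containing the
  -- speaker's data do not change. What remains is that conditioning on the other terminal's data
  -- cannot increase the entropy of the new symbol, which is submodularity.
  by_cases ht : c.aliceSpeaks t = true
  · have hs := fun v w : c.Sample Z => c.symbol_congr_alice ht (v := v) (w := w)
    have e1 : rvEntropy (c.prob P)
        (fun w => (c.dataA w, c.symbols (t + 1) w, fun l => ζ (w.1 l).2.2)) =
        rvEntropy (c.prob P) (fun w => (c.dataA w, c.symbols t w, fun l => ζ (w.1 l).2.2)) :=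
      rvEntropy_congr fun v w => by
        simp only [Prod.mk.injEq, hsucc]
        exact ⟨fun h => ⟨h.1, h.2.1.1, h.2.2⟩, fun h => ⟨h.1, ⟨h.2.1, hs _ _ h.1 h.2.1⟩, h.2.2⟩⟩
    have e2 : rvEntropy (c.prob P)
        (fun w => (c.dataA w, c.dataB w, c.symbols (t + 1) w, fun l => ζ (w.1 l).2.2)) =
        rvEntropy (c.prob P)
          (fun w => (c.dataA w, c.dataB w, c.symbols t w, fun l => ζ (w.1 l).2.2)) :=
      rvEntropy_congr fun v w => by
        simp only [Prod.mk.injEq, hsucc]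
        exact ⟨fun h => ⟨h.1, h.2.1, h.2.2.1.1, h.2.2.2⟩,
          fun h => ⟨h.1, h.2.1, ⟨h.2.2.1, hs _ _ h.1 h.2.2.1⟩, h.2.2.2⟩⟩
    have e3 := rvEntropy_submodular hp
      (f₁ := fun w => (c.dataB w, c.symbols t w, fun l => ζ (w.1 l).2.2))
      (f₂ := fun w => (c.symbols (t + 1) w, fun l => ζ (w.1 l).2.2))
      (f₁₂ := fun w => (c.dataB w, c.symbols (t + 1) w, fun l => ζ (w.1 l).2.2))
      (f₀ := fun w => (c.symbols t w, fun l => ζ (w.1 l).2.2))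
      (fun v w => by simp only [Prod.mk.injEq, hsucc]; tauto)
      (fun v w => by simp only [Prod.mk.injEq]; tauto)
      (fun v w => by simp only [Prod.mk.injEq, hsucc]; tauto)
    linarith
  · have hs := fun v w : c.Sample Z => c.symbol_congr_bob ht (v := v) (w := w)
    have e1 : rvEntropy (c.prob P)
        (fun w => (c.dataB w, c.symbols (t + 1) w, fun l => ζ (w.1 l).2.2)) =
        rvEntropy (c.prob P) (fun w => (c.dataB w, c.symbols t w, fun l => ζ (w.1 l).2.2)) :=
      rvEntropy_congr fun v w => by
        simp only [Prod.mk.injEq, hsucc]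
        exact ⟨fun h => ⟨h.1, h.2.1.1, h.2.2⟩, fun h => ⟨h.1, ⟨h.2.1, hs _ _ h.1 h.2.1⟩, h.2.2⟩⟩
    have e2 : rvEntropy (c.prob P)
        (fun w => (c.dataA w, c.dataB w, c.symbols (t + 1) w, fun l => ζ (w.1 l).2.2)) =
        rvEntropy (c.prob P)
          (fun w => (c.dataA w, c.dataB w, c.symbols t w, fun l => ζ (w.1 l).2.2)) :=
      rvEntropy_congr fun v w => by
        simp only [Prod.mk.injEq, hsucc]
        exact ⟨fun h => ⟨h.1, h.2.1, h.2.2.1.1, h.2.2.2⟩,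
          fun h => ⟨h.1, h.2.1, ⟨h.2.2.1, hs _ _ h.2.1 h.2.2.1⟩, h.2.2.2⟩⟩
    have e3 := rvEntropy_submodular hp
      (f₁ := fun w => (c.dataA w, c.symbols t w, fun l => ζ (w.1 l).2.2))
      (f₂ := fun w => (c.symbols (t + 1) w, fun l => ζ (w.1 l).2.2))
      (f₁₂ := fun w => (c.dataA w, c.symbols (t + 1) w, fun l => ζ (w.1 l).2.2))
      (f₀ := fun w => (c.symbols t w, fun l => ζ (w.1 l).2.2))
      (fun v w => by simp only [Prod.mk.injEq, hsucc]; tauto)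
      (fun v w => by simp only [Prod.mk.injEq]; tauto)
      (fun v w => by simp only [Prod.mk.injEq, hsucc]; tauto)
    linarith

/-- Before any symbol is sent, private randomness adds its entropy to each terminal's term and the
same total to the joint term, so it cancels. -/
theorem residualInfo_zero (c : Protocol X Y n k a M) {P : X × Y × Z → ℝ}
    (hP : P ∈ stdSimplex ℝ (X × Y × Z)) (ζ : Z → Z') :
    c.residualInfo P ζ 0 =
      n * condMutualInfo (law P (fun s => (s.1, s.2.1, ζ s.2.2))) := by
  have hi := iid_mem hP n
  have hr := prodLaw_mem c.pA_mem c.pB_mem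
  have e1 : rvEntropy (c.prob P)
      (fun w => (c.dataA w, c.symbols 0 w, fun l => ζ (w.1 l).2.2)) =
      n * rvEntropy P (fun s => (s.1, ζ s.2.2)) + rvEntropy c.pA id := by
    rw [← rvEntropy_iid hP]
    have := rvEntropy_prodLaw hi hr (fun w i => ((w i).1, ζ (w i).2.2)) (fun r => (id r.1, ()))
    rw [rvEntropy_prodLaw c.pA_mem c.pB_mem id (fun _ => ()),
      rvEntropy_const c.pB_mem (g := fun _ => ()) (fun _ _ => rfl), add_zero] at this
    rw [← this, prob_eq]
    refine rvEntropy_congr fun v w => ?_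
    simp only [dataA, Prod.mk.injEq, funext_iff, IsEmpty.forall_iff, forall_and, id]
    tauto
  have e2 : rvEntropy (c.prob P)
      (fun w => (c.dataB w, c.symbols 0 w, fun l => ζ (w.1 l).2.2)) =
      n * rvEntropy P (fun s => (s.2.1, ζ s.2.2)) + rvEntropy c.pB id := by
    rw [← rvEntropy_iid hP]
    have := rvEntropy_prodLaw hi hr (fun w i => ((w i).2.1, ζ (w i).2.2)) (fun r => ((), id r.2))
    rw [rvEntropy_prodLaw c.pA_mem c.pB_mem (fun _ => ()) id,
      rvEntropy_const c.pA_mem (g := fun _ => ()) (fun _ _ => rfl), zero_add] at this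
    rw [← this, prob_eq]
    refine rvEntropy_congr fun v w => ?_
    simp only [dataB, Prod.mk.injEq, funext_iff, IsEmpty.forall_iff, forall_and, id]
    tauto
  have e3 : rvEntropy (c.prob P)
      (fun w => (c.dataA w, c.dataB w, c.symbols 0 w, fun l => ζ (w.1 l).2.2)) =
      n * rvEntropy P (fun s => (s.1, s.2.1, ζ s.2.2)) +
        (rvEntropy c.pA id + rvEntropy c.pB id) := by
    rw [← rvEntropy_iid hP, ← rvEntropy_prodLaw c.pA_mem c.pB_mem, ← rvEntropy_prodLaw hi hr,
      prob_eq]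
    refine rvEntropy_congr fun v w => ?_
    simp only [dataA, dataB, Prod.mk.injEq, funext_iff, IsEmpty.forall_iff, forall_and, id]
    tauto
  have e4 : rvEntropy (c.prob P) (fun w => (c.symbols 0 w, fun l => ζ (w.1 l).2.2)) =
      n * rvEntropy P (fun s => ζ s.2.2) := by
    rw [← rvEntropy_iid hP, ← add_zero (rvEntropy (iid P n) _),
      ← rvEntropy_const hr (g := fun _ => ()) (fun _ _ => rfl), ← rvEntropy_prodLaw hi hr, prob_eq]
    refine rvEntropy_congr fun v w => ?_
    simp only [Prod.mk.injEq, funext_iff, IsEmpty.forall_iff]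
    tauto
  rw [residualInfo, e1, e2, e3, e4, condMutualInfo_law hP.1]
  ring

theorem residualInfo_le (c : Protocol X Y n k a M) {P : X × Y × Z → ℝ}
    (hP : P ∈ stdSimplex ℝ (X × Y × Z)) (ζ : Z → Z') (t : ℕ) :
    c.residualInfo P ζ t ≤ n * condMutualInfo (law P (fun s => (s.1, s.2.1, ζ s.2.2))) := by
  induction t with
  | zero => exact (c.residualInfo_zero hP ζ).le
  | succ t ih => exact (c.residualInfo_succ_le hP ζ t).trans ih

/-- Entropy of the key is at most its leakage, plus its equivocation at Bob, plus the initial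
conditional mutual information of the terminals. -/
theorem entropy_key_le (c : Protocol X Y n k a M) {P : X × Y × Z → ℝ}
    (hP : P ∈ stdSimplex ℝ (X × Y × Z)) (ζ : Z → Z') :
    rvEntropy (c.prob P) c.key ≤
      (rvEntropy (c.prob P) c.key + rvEntropy (c.prob P) c.wardenView -
        rvEntropy (c.prob P) (fun w => (c.key w, c.wardenView w))) +
      (rvEntropy (c.prob P) (fun w => (c.key w, c.keyHat w)) - rvEntropy (c.prob P) c.keyHat) +
      n * condMutualInfo (law P (fun s => (s.1, s.2.1, ζ s.2.2))) := by
  have hp := (c.prob_mem hP).1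
  have hF := fun v w => (c.discussion_eq_iff (Z := Z) v w).2
  have hF' := fun v w => (c.discussion_eq_iff (Z := Z) v w).1
  have hr := c.residualInfo_le hP ζ (n * k)
  unfold residualInfo at hr
  set V := fun w : c.Sample Z => (c.symbols (n * k) w, fun l => ζ (w.1 l).2.2) with hV
  -- Data processing, `I(K; V) ≤ I(K; Zⁿ F)`, because `V` is a function of the warden's view.
  have s1 := rvEntropy_submodular hp (f₁ := fun w => (c.key w, V w)) (f₂ := c.wardenView)
    (f₁₂ := fun w => (c.key w, c.wardenView w)) (f₀ := V)
    (fun v w => by simp only [Prod.mk.injEq]; tauto)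
    (fun v w => by simp only [Prod.mk.injEq]; tauto)
    (fun v w => by
      simp only [hV, wardenView, Prod.mk.injEq]
      exact fun h => ⟨hF' v w h.2, funext fun l => by rw [congrFun h.1 l]⟩)
  -- `I(K; B | V) ≤ I(A; B | V)`, because Alice's data and the discussion determine `K`.
  have s2 := rvEntropy_submodular hp
    (f₁ := fun w => (c.dataA w, c.symbols (n * k) w, fun l => ζ (w.1 l).2.2))
    (f₂ := fun w => (c.key w, c.dataB w, V w))
    (f₁₂ := fun w => (c.dataA w, c.dataB w, c.symbols (n * k) w, fun l => ζ (w.1 l).2.2))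
    (f₀ := fun w => (c.key w, V w))
    (fun v w => by simp only [Prod.mk.injEq]; tauto)
    (fun v w => by
      simp only [hV, Prod.mk.injEq]
      exact fun h => ⟨c.key_congr h.1 (hF _ _ h.2.1), h.2⟩)
    (fun v w => by simp only [Prod.mk.injEq]; tauto)
  -- `H(K | B, V) ≤ H(K | K̂)`, because Bob's data and the discussion determine `K̂`.
  have s3 := rvEntropy_submodular hp
    (f₁ := fun w => (c.key w, c.keyHat w))
    (f₂ := fun w => (c.dataB w, c.symbols (n * k) w, fun l => ζ (w.1 l).2.2))
    (f₁₂ := fun w => (c.key w, c.dataB w, V w))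
    (f₀ := c.keyHat)
    (fun v w => by simp only [hV, Prod.mk.injEq]; tauto)
    (fun v w => by simp only [Prod.mk.injEq]; tauto)
    (fun v w => by
      simp only [Prod.mk.injEq]
      exact fun h => c.keyHat_congr h.1 (hF _ _ h.2.1))
  linarith

theorem nonConfusion_eq (c : Protocol X Y n k a M) {P : X × Y × Z → ℝ}
    (hP : P ∈ stdSimplex ℝ (X × Y × Z)) :
    c.nonConfusion P = ((rvEntropy (c.prob P) c.key + rvEntropy (c.prob P) c.wardenView -
      rvEntropy (c.prob P) (fun w => (c.key w, c.wardenView w)) : ℝ) : EReal) :=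
  divergence_joint (c.prob_mem hP).1 _ _

theorem nonStealth_nonneg {u : ℕ} (c : Protocol X Y n k a M) {P : X × Y × Z → ℝ}
    (hP : P ∈ stdSimplex ℝ (X × Y × Z)) (W : ConceptualChannel X Y k a u) :
    0 ≤ c.nonStealth P W :=
  divergence_nonneg (law_mem (c.prob_mem hP) _) (W.target_mem hP n)

end Protocol

theorem logb_natCeil_le {x : ℝ} (hx : 0 ≤ x) : Real.logb 2 ⌈(2 : ℝ) ^ x⌉₊ ≤ x + 1 := by
  have h1 : (1 : ℝ) ≤ 2 ^ x := Real.one_le_rpow one_le_two hx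
  have h0 : (0 : ℝ) < ⌈(2 : ℝ) ^ x⌉₊ := by exact_mod_cast Nat.ceil_pos.2 (by linarith)
  rw [Real.logb_le_iff_le_rpow one_lt_two h0, Real.rpow_add two_pos, Real.rpow_one]
  linarith [Nat.ceil_lt_add_one (by linarith : (0 : ℝ) ≤ 2 ^ x)]

theorem le_logb_natCeil (x : ℝ) : x ≤ Real.logb 2 ⌈(2 : ℝ) ^ x⌉₊ := by
  have h0 : (0 : ℝ) < 2 ^ x := by positivity
  have h1 := Nat.le_ceil ((2 : ℝ) ^ x)
  rw [Real.le_logb_iff_rpow_le one_lt_two (by linarith)]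
  exact h1

/-! ### The converse bound. -/

section Converse

variable {X Y Z Z' : Type*} [Fintype X] [Fintype Y] [Fintype Z] [Fintype Z']

/-- Achievable rates are at most `I(X; Y | Z')` for every function `Z'` of `Z`. -/
theorem Achievable.le_condMutualInfo {P : X × Y × Z → ℝ} (hP : P ∈ stdSimplex ℝ (X × Y × Z))
    {R : ℝ} (hR : Achievable P R) (ζ : Z → Z') :
    R ≤ condMutualInfo (law P (fun s => (s.1, s.2.1, ζ s.2.2))) := by
  obtain ⟨hR0, k, a, u, W, -, h⟩ := hR
  set I := condMutualInfo (law P (fun s => (s.1, s.2.1, ζ s.2.2))) with hI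
  by_contra hlt
  push Not at hlt
  -- The Fano term costs `ε n R`, which must consume at most half of the gap `n (R - I)`. With `ε ≤
  -- 1` the additive constants sum to at most 5, so `n (R - I) > 10` would already contradict; 14 is
  -- a safe choice.
  set ε : ℝ := min 1 ((R - I) / (2 * (R + 1))) with hε
  have hε0 : 0 < ε := lt_min one_pos (div_pos (by linarith) (by linarith))
  have hε1 : ε ≤ 1 := min_le_left _ _
  have hε2 : ε * R ≤ (R - I) / 2 := by
    have : ε ≤ (R - I) / (2 * (R + 1)) := min_le_right _ _
    rw [le_div_iff₀ (by linarith)] at this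
    nlinarith
  obtain ⟨N, hN⟩ := exists_nat_gt (14 / (R - I))
  obtain ⟨n, ⟨c, herr, huni, hsec⟩, hn⟩ :=
    ((h ε hε0).and (Filter.eventually_ge_atTop N)).exists
  have hnR : 14 < n * (R - I) := by
    rw [div_lt_iff₀ (by linarith)] at hN
    have : (N : ℝ) ≤ n := by exact_mod_cast hn
    nlinarith
  have hconf : rvEntropy (c.prob P) c.key + rvEntropy (c.prob P) c.wardenView -
      rvEntropy (c.prob P) (fun w => (c.key w, c.wardenView w)) ≤ ε := by
    have h1 : c.nonConfusion P ≤ ε :=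
      le_trans (le_add_of_nonneg_right (c.nonStealth_nonneg hP W)) hsec
    rw [c.nonConfusion_eq hP] at h1
    exact_mod_cast h1
  have hfano := rvEntropy_fano (c.prob_mem hP) c.key c.keyHat (e := 1 / 2) (by norm_num)
    (by norm_num)
  have hkey := c.entropy_key_le hP ζ
  have hnR0 : 0 ≤ (n : ℝ) * R := by positivity
  have hM := logb_natCeil_le hnR0
  have hM' := le_logb_natCeil ((n : ℝ) * R)
  have l2 : Real.logb 2 (1 - 1 / 2) = -1 := by
    rw [show (1 - 1 / 2 : ℝ) = 2⁻¹ by norm_num, Real.logb_inv, Real.logb_self_eq_one one_lt_two]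
  have l3 : Real.logb 2 (1 / (1 / 2)) = 1 := by
    rw [one_div_one_div, Real.logb_self_eq_one one_lt_two]
  rw [l2, l3, Fintype.card_fin] at hfano
  have herr' : (∑ w : c.Sample Z, if c.key w ≠ c.keyHat w then c.prob P w else 0) ≤ ε := herr
  have huni' : Real.logb 2 (⌈(2 : ℝ) ^ ((n : ℝ) * R)⌉₊ : ℝ) - rvEntropy (c.prob P) c.key ≤ ε :=
    huni
  have hprod : (∑ w : c.Sample Z, if c.key w ≠ c.keyHat w then c.prob P w else 0) *
      (1 + Real.logb 2 (⌈(2 : ℝ) ^ ((n : ℝ) * R)⌉₊ : ℝ)) ≤ ε * (n * R + 2) := by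
    refine mul_le_mul herr' (by linarith) (by linarith) hε0.le
  nlinarith

end Converse

/-! ### One-shot analysis of random hashing. -/

section RandomHash

theorem sum_ite_eq_one {U : Type*} [Fintype U] (u : U) [∀ v : U, Decidable (v = u)] :
    (∑ v, if v = u then (1 : ℝ) else 0) = 1 := by
  rw [Finset.sum_eq_single u] <;> simp +contextual

open Classical in
/-- A uniformly random function collides at two distinct points with probability `1 / c`, where
collision is understood after applying a map `φ` all of whose fibres have density `1 / c`. -/
theorem sum_collision {𝒳 T U : Type*} [Fintype 𝒳] [Fintype T] {x x' : 𝒳}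
    (hx : x' ≠ x) (φ : T → U) {c : ℝ}
    (hφ : ∀ t₀, (∑ t : T, if φ t = φ t₀ then (1 : ℝ) else 0) * c = Fintype.card T) :
    (∑ g : 𝒳 → T, if φ (g x) = φ (g x') then (1 : ℝ) else 0) * c = Fintype.card (𝒳 → T) := by
  -- Separate the value at `x` from the rest of the function: with the value at `x'` fixed, the
  -- value at `x` is still uniform.
  have e := (Equiv.funSplitAt x T).symm.sum_comp
    (fun g : 𝒳 → T => if φ (g x) = φ (g x') then (1 : ℝ) else 0)
  have hc : Fintype.card (𝒳 → T) = Fintype.card T * Fintype.card ({j // j ≠ x} → T) := by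
    rw [← Fintype.card_prod]; exact Fintype.card_congr (Equiv.funSplitAt x T)
  rw [← e, Fintype.sum_prod_type_right, hc, Finset.sum_mul]
  simp only [Equiv.funSplitAt_symm_apply, dite_true, dif_neg hx]
  rw [Finset.sum_congr rfl fun h _ => hφ (h ⟨x', hx⟩)]
  simp [mul_comm]

/-- Subadditivity of `t ↦ t ^ s`, followed by `log (1 + v) ≤ v`. It trades a logarithm, which does
not factor over letters, for a power, which does. -/
theorem log_one_add_le_rpow {t s : ℝ} (ht : 0 ≤ t) (hs : 0 < s) (hs1 : s ≤ 1) :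
    Real.log (1 + t) ≤ t ^ s / s := by
  have h1 : (1 + t) ^ s ≤ 1 + t ^ s := by
    simpa using Real.rpow_add_le_add_rpow zero_le_one ht hs.le hs1
  have h2 : 0 ≤ t ^ s := by positivity
  rw [le_div_iff₀ hs, mul_comm, ← Real.log_rpow (by linarith)]
  calc Real.log ((1 + t) ^ s) ≤ Real.log (1 + t ^ s) :=
        Real.log_le_log (by positivity) h1
    _ ≤ t ^ s := by linarith [Real.log_le_sub_one_of_pos (by linarith : 0 < 1 + t ^ s)]

/-- Jensen's inequality for the logarithm, by its tangent line at `Y`; it moves the average over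
hash functions inside the logarithm. -/
theorem sum_log_le {ι : Type*} [Fintype ι] {y : ι → ℝ} {Y : ℝ} (hy : ∀ i, 0 < y i) (hY : 0 < Y)
    (h : ∑ i, y i ≤ Fintype.card ι * Y) : ∑ i, Real.log (y i) ≤ Fintype.card ι * Real.log Y := by
  have h1 : ∀ i, Real.log (y i) ≤ Real.log Y + (y i / Y - 1) := fun i => by
    have := Real.log_le_sub_one_of_pos (div_pos (hy i) hY)
    rw [Real.log_div (hy i).ne' hY.ne'] at this
    linarith
  refine (Finset.sum_le_sum fun i _ => h1 i).trans ?_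
  rw [Finset.sum_add_distrib, Finset.sum_sub_distrib, ← Finset.sum_div]
  have : (∑ i, y i) / Y ≤ Fintype.card ι := (div_le_iff₀ hY).2 h
  simp
  linarith

variable {𝒳 𝒴 𝒵 T U : Type*} [Fintype 𝒳] [Fintype 𝒴] [Fintype 𝒵] [Fintype T]

/-- Joint distance to uniformity and leakage of a hash value: `log N - H(g(X) | Z)`. -/
def hashLeakage (q : 𝒳 × 𝒵 → ℝ) (g : 𝒳 → T) : ℝ :=
  Real.logb 2 (Fintype.card T) + rvEntropy q Prod.snd - rvEntropy q (fun s => (g s.1, s.2))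

/-- Subadditivity of entropy and `H ≤ log |T|`. Nonnegativity lets one bound on leakage plus
weighted decoding error control each summand. -/
theorem hashLeakage_nonneg {q : 𝒳 × 𝒵 → ℝ} (hq : q ∈ stdSimplex ℝ (𝒳 × 𝒵)) (g : 𝒳 → T) :
    0 ≤ hashLeakage q g := by
  have h1 := rvEntropy_submodular hq.1 (f₁ := fun s => g s.1) (f₂ := Prod.snd)
    (f₁₂ := fun s => (g s.1, s.2)) (f₀ := fun _ => ()) (fun a b h h' => by simp [h, h'])
    (fun _ _ _ => rfl) (fun _ _ _ => rfl)
  rw [rvEntropy_const hq (g := fun _ => ()) (fun _ _ => rfl)] at h1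
  have h2 := rvEntropy_le_logb_card hq (fun s => g s.1)
  unfold hashLeakage
  linarith

theorem hashLeakage_eq [Nonempty T] {q : 𝒳 × 𝒵 → ℝ} (hq : q ∈ stdSimplex ℝ (𝒳 × 𝒵))
    (g : 𝒳 → T) :
    hashLeakage q g = ∑ s, q s * Real.logb 2 (Fintype.card T *
      law q (fun s => (g s.1, s.2)) (g s.1, s.2) / law q Prod.snd s.2) := by
  have h0 : Real.logb 2 (Fintype.card T) = ∑ s, q s * Real.logb 2 (Fintype.card T) := by
    rw [← Finset.sum_mul, hq.2, one_mul]
  rw [hashLeakage, h0, rvEntropy_eq, rvEntropy_eq, sub_neg_eq_add, ← sub_eq_add_neg,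
    ← Finset.sum_sub_distrib, ← Finset.sum_add_distrib]
  refine Finset.sum_congr rfl fun s _ => ?_
  by_cases hs : q s = 0
  · simp [hs]
  · have h1 := (law_pos hq.1 (fun s => (g s.1, s.2)) hs).ne'
    have h2 := (law_pos hq.1 Prod.snd hs).ne'
    have h3 : (Fintype.card T : ℝ) ≠ 0 := by exact_mod_cast Fintype.card_ne_zero
    rw [Real.logb_div (mul_ne_zero h3 h1) h2, Real.logb_mul h3 h1]
    ring

open Classical in
-- The bin of `x` always contains `x`, and any other point with probability `1 / |T|`.
theorem sum_law_hash_le [Nonempty T] {q : 𝒳 × 𝒵 → ℝ} (hq : ∀ s, 0 ≤ q s) (x : 𝒳) (z : 𝒵) :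
    ∑ g : 𝒳 → T, law q (fun s => (g s.1, s.2)) (g x, z) * Fintype.card T ≤
      Fintype.card (𝒳 → T) * (q (x, z) * Fintype.card T + law q Prod.snd z) := by
  have h1 : ∀ g : 𝒳 → T, law q (fun s => (g s.1, s.2)) (g x, z) =
      ∑ x', q (x', z) * if g x' = g x then 1 else 0 := by
    intro g
    unfold law
    rw [Fintype.sum_prod_type]
    refine Finset.sum_congr rfl fun x' _ => ?_
    by_cases h : g x' = g x <;> simp [h]
  have h2 : law q Prod.snd z = ∑ x', q (x', z) := by
    unfold law
    rw [Fintype.sum_prod_type]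
    simp
  simp_rw [h1, h2]
  rw [← Finset.sum_mul, Finset.sum_comm, Finset.sum_mul, mul_add, Finset.mul_sum]
  calc ∑ x', (∑ g : 𝒳 → T, q (x', z) * if g x' = g x then 1 else 0) * (Fintype.card T : ℝ)
      ≤ ∑ x', ((if x' = x then Fintype.card (𝒳 → T) * (q (x, z) * Fintype.card T) else 0) +
          Fintype.card (𝒳 → T) * q (x', z)) := by
        refine Finset.sum_le_sum fun x' _ => ?_
        have hq' := hq (x', z)
        by_cases h : x' = x
        · subst h
          simp [mul_assoc]
          positivity
        · have := sum_collision (T := T) (fun h' => h h'.symm : x ≠ x') id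
            (c := Fintype.card T) (fun t₀ => by simp)
          simp only [id] at this
          rw [← Finset.mul_sum, mul_assoc, this, if_neg h, zero_add, mul_comm]
    _ = _ := by
        rw [Finset.sum_add_distrib]
        simp

open Classical in
/-- Average leakage of a random hash function. -/
theorem sum_hashLeakage_le [Nonempty T] {q : 𝒳 × 𝒵 → ℝ} (hq : q ∈ stdSimplex ℝ (𝒳 × 𝒵))
    {σ : ℝ} (hσ : 0 < σ) (hσ1 : σ ≤ 1) :
    ∑ g : 𝒳 → T, hashLeakage q g ≤ Fintype.card (𝒳 → T) *
      ((Fintype.card T : ℝ) ^ σ / (σ * Real.log 2) *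
        ∑ s, q s * (q s / law q Prod.snd s.2) ^ σ) := by
  simp_rw [hashLeakage_eq hq]
  rw [Finset.sum_comm, Finset.mul_sum, Finset.mul_sum]
  refine Finset.sum_le_sum fun s _ => ?_
  rw [← Finset.mul_sum]
  by_cases hs : q s = 0
  · simp [hs]
  have hs0 : 0 < q s := lt_of_le_of_ne (hq.1 s) (Ne.symm hs)
  have hz : 0 < law q Prod.snd s.2 := law_pos hq.1 Prod.snd hs
  have hN : (0 : ℝ) < Fintype.card T := by exact_mod_cast Fintype.card_pos
  have hl2 : 0 < Real.log 2 := Real.log_pos one_lt_two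
  set t : ℝ := Fintype.card T * (q s / law q Prod.snd s.2) with ht
  have ht0 : 0 ≤ t := by positivity
  -- For fixed `(x, z)` the normalized bin mass averages to at most `1 + t` over the hash functions,
  -- where `t = |T| q(x | z)`.
  have hlog := sum_log_le (ι := 𝒳 → T) (y := fun g => Fintype.card T *
      law q (fun s => (g s.1, s.2)) (g s.1, s.2) / law q Prod.snd s.2) (Y := 1 + t)
    (fun g => div_pos (mul_pos hN (law_pos hq.1 (fun s => (g s.1, s.2)) hs)) hz) (by linarith) (by
      rw [← Finset.sum_div, div_le_iff₀ hz]
      refine (Finset.sum_congr rfl fun g _ => mul_comm _ _).trans_le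
        ((sum_law_hash_le hq.1 s.1 s.2).trans_eq ?_)
      rw [ht]
      field_simp
      ring)
  have hlog2 := log_one_add_le_rpow ht0 hσ hσ1
  rw [ht, Real.mul_rpow hN.le (by positivity)] at hlog2
  simp only [Real.logb]
  rw [← Finset.sum_div]
  have hG : (0 : ℝ) ≤ Fintype.card (𝒳 → T) := Nat.cast_nonneg _
  calc _ ≤ q s * (Fintype.card (𝒳 → T) * ((Fintype.card T : ℝ) ^ σ *
          (q s / law q Prod.snd s.2) ^ σ / σ) / Real.log 2) := by
        refine mul_le_mul_of_nonneg_left (div_le_div_of_nonneg_right (hlog.trans ?_) hl2.le) hs0.le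
        exact mul_le_mul_of_nonneg_left hlog2 hG
    _ = _ := by field_simp

/-- A maximum likelihood decoder from side information and a hash value. -/
theorem exists_decoder {𝒴 : Type*} [Nonempty 𝒳] (r : 𝒳 × 𝒴 → ℝ) (f : 𝒳 → U) :
    ∃ dec : 𝒴 → U → 𝒳, ∀ x y, dec y (f x) ≠ x →
      ∃ x', x' ≠ x ∧ f x' = f x ∧ r (x, y) ≤ r (x', y) := by
  classical
  have h : ∀ (y : 𝒴) (u : U), ∃ x₀, ∀ x, f x = u → f x₀ = u ∧ r (x, y) ≤ r (x₀, y) := by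
    intro y u
    by_cases hne : (Finset.univ.filter fun x => f x = u).Nonempty
    · obtain ⟨x₀, h0, h1⟩ := Finset.exists_max_image _ (fun x => r (x, y)) hne
      exact ⟨x₀, fun x hx => ⟨(Finset.mem_filter.1 h0).2, h1 x (by simp [hx])⟩⟩
    · refine ⟨Classical.arbitrary 𝒳, fun x hx => absurd ⟨x, by simp [hx]⟩ hne⟩
  choose dec hdec using h
  exact ⟨dec, fun x y hx => ⟨dec y (f x), hx, hdec y (f x) x rfl⟩⟩

open Classical in
/-- Probability that some other point of at least the same likelihood has the same value of `f`. -/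
def confusionProb (r : 𝒳 × 𝒴 → ℝ) (f : 𝒳 → U) : ℝ :=
  ∑ s : 𝒳 × 𝒴, if ∃ x', x' ≠ s.1 ∧ f x' = f s.1 ∧ r s ≤ r (x', s.2) then r s else 0

open Classical in
/-- Average probability that some other point of at least the same likelihood has the same
hash value. -/
theorem sum_confusion_le {r : 𝒳 × 𝒴 → ℝ} (hr : r ∈ stdSimplex ℝ (𝒳 × 𝒴)) (φ : T → U) {c : ℝ}
    (hc : 0 < c)
    (hφ : ∀ t₀, (∑ t : T, if φ t = φ t₀ then (1 : ℝ) else 0) * c = Fintype.card T)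
    {τ : ℝ} (hτ : 0 < τ) (hτ1 : τ ≤ 1) :
    ∑ g : 𝒳 → T, confusionProb r (fun x => φ (g x)) ≤
      Fintype.card (𝒳 → T) * ∑ s, r s * (law r Prod.snd s.2 / (c * r s)) ^ τ := by
  unfold confusionProb
  rw [Finset.sum_comm, Finset.mul_sum]
  refine Finset.sum_le_sum fun s _ => ?_
  by_cases hs : r s = 0
  · simp [hs]
  have hs0 : 0 < r s := lt_of_le_of_ne (hr.1 s) (Ne.symm hs)
  have hy : 0 < law r Prod.snd s.2 := law_pos hr.1 Prod.snd hs
  set G : ℝ := (Fintype.card (𝒳 → T) : ℝ) with hG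
  have hG0 : 0 ≤ G := Nat.cast_nonneg _
  set t := law r Prod.snd s.2 / (c * r s) with ht
  have ht0 : 0 < t := by positivity
  set E : (𝒳 → T) → Prop := fun g =>
    ∃ x', x' ≠ s.1 ∧ φ (g x') = φ (g s.1) ∧ r s ≤ r (x', s.2) with hE
  -- The average probability of `E` is at most 1 and, by the next bound, at most `t`; finally `min 1
  -- t ≤ t ^ τ`.
  have key1 : ∑ g, (if E g then r s else 0) ≤ G * r s := by
    calc ∑ g, (if E g then r s else 0) ≤ ∑ _g : 𝒳 → T, r s :=
          Finset.sum_le_sum fun g _ => by split_ifs <;> linarith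
      _ = G * r s := by simp [hG]
  -- Union bound: a competitor satisfies `r s ≤ r (x', s.2)`, so its own mass can replace `r s`;
  -- each pair collides with probability `1 / c`.
  have key2 : ∑ g, (if E g then r s else 0) ≤ G * (r s * t) := by
    have h2 : law r Prod.snd s.2 = ∑ x', r (x', s.2) := by
      unfold law
      rw [Fintype.sum_prod_type]
      simp
    calc ∑ g, (if E g then r s else 0)
        ≤ ∑ g : 𝒳 → T, ∑ x', (if x' ≠ s.1 ∧ φ (g x') = φ (g s.1) then r (x', s.2) else 0) := by
          refine Finset.sum_le_sum fun g _ => ?_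
          have hnn : ∀ x', 0 ≤ if x' ≠ s.1 ∧ φ (g x') = φ (g s.1) then r (x', s.2) else 0 :=
            fun x' => by split_ifs; exacts [hr.1 _, le_rfl]
          split_ifs with h
          · obtain ⟨x', h1, h2, h3⟩ := h
            refine h3.trans (le_trans ?_
              (Finset.single_le_sum (fun x _ => hnn x) (Finset.mem_univ x')))
            rw [if_pos ⟨h1, h2⟩]
          · exact Finset.sum_nonneg fun x _ => hnn x
      _ = ∑ x', r (x', s.2) *
            ∑ g : 𝒳 → T, (if x' ≠ s.1 ∧ φ (g x') = φ (g s.1) then (1 : ℝ) else 0) := by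
          rw [Finset.sum_comm]
          simp_rw [Finset.mul_sum, mul_ite, mul_one, mul_zero]
      _ ≤ ∑ x', r (x', s.2) * (G / c) := by
          refine Finset.sum_le_sum fun x' _ => mul_le_mul_of_nonneg_left ?_ (hr.1 _)
          by_cases h : x' = s.1
          · simp [h]; positivity
          · rw [le_div_iff₀ hc, hG, ← sum_collision (Ne.symm h) φ hφ]
            simp [h]
      _ = G * (r s * t) := by
          rw [← Finset.sum_mul, ← h2, ht]
          field_simp
  have hmul : 0 ≤ r s * G := by positivity
  rcases le_total t 1 with h | h
  · have : t ≤ t ^ τ := by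
      simpa using Real.rpow_le_rpow_of_exponent_ge ht0 h hτ1
    exact key2.trans (mul_le_mul_of_nonneg_left (mul_le_mul_of_nonneg_left this hs0.le) hG0)
  · have : 1 ≤ t ^ τ := Real.one_le_rpow h hτ.le
    refine key1.trans (mul_le_mul_of_nonneg_left ?_ hG0)
    nlinarith

open Classical in
/-- Probability that `dec` fails to recover `X` from `Y` and `f(X)`. -/
def decodingError (r : 𝒳 × 𝒴 → ℝ) (f : 𝒳 → U) (dec : 𝒴 → U → 𝒳) : ℝ :=
  ∑ s, if dec s.2 (f s.1) ≠ s.1 then r s else 0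

theorem decodingError_nonneg {r : 𝒳 × 𝒴 → ℝ} (hr : ∀ s, 0 ≤ r s) (f : 𝒳 → U)
    (dec : 𝒴 → U → 𝒳) : 0 ≤ decodingError r f dec :=
  Finset.sum_nonneg fun s _ => by split_ifs; exacts [hr s, le_rfl]

open Classical in
/-- One-shot existence of a pair of hash functions `(κ, s)` that is nearly uniform and independent
of `Z`, such that `X` can be decoded from `Y` and `s(X)`. -/
theorem exists_hash_pair [Nonempty 𝒳] {q : 𝒳 × 𝒵 → ℝ}
    (hq : q ∈ stdSimplex ℝ (𝒳 × 𝒵)) {r : 𝒳 × 𝒴 → ℝ} (hr : r ∈ stdSimplex ℝ (𝒳 × 𝒴))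
    {M S : ℕ} (hM : 0 < M) (hS : 0 < S)
    {σ τ w : ℝ} (hσ : 0 < σ) (hσ1 : σ ≤ 1) (hτ : 0 < τ) (hτ1 : τ ≤ 1) (hw : 0 ≤ w) :
    ∃ (g : 𝒳 → Fin M × Fin S) (dec : 𝒴 → Fin S → 𝒳),
      hashLeakage q g + w * decodingError r (fun x => (g x).2) dec ≤
        ((M * S : ℕ) : ℝ) ^ σ / (σ * Real.log 2) * (∑ s, q s * (q s / law q Prod.snd s.2) ^ σ) +
          w * ∑ s, r s * (law r Prod.snd s.2 / (S * r s)) ^ τ := by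
  have : Nonempty (Fin M × Fin S) := ⟨⟨0, hM⟩, ⟨0, hS⟩⟩
  have h1 := sum_hashLeakage_le (T := Fin M × Fin S) hq hσ hσ1
  have h2 := sum_confusion_le (T := Fin M × Fin S) hr Prod.snd (c := S) (by exact_mod_cast hS)
    (fun t₀ => by
      rw [Fintype.sum_prod_type, Finset.sum_congr rfl fun x _ =>
        (Finset.sum_congr rfl fun y _ => by congr).trans (sum_ite_eq_one t₀.2)]
      simp) hτ hτ1
  rw [Fintype.card_prod, Fintype.card_fin, Fintype.card_fin] at h1
  set A := ((M * S : ℕ) : ℝ) ^ σ / (σ * Real.log 2) *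
    (∑ s, q s * (q s / law q Prod.snd s.2) ^ σ)
  set B := ∑ s, r s * (law r Prod.snd s.2 / (S * r s)) ^ τ
  set C : (𝒳 → Fin M × Fin S) → ℝ := fun g => confusionProb r (fun x => (g x).2)
  -- Averaging the weighted sum, rather than each criterion separately, yields a single hash
  -- function good for both.
  obtain ⟨g, -, hg⟩ := Finset.exists_le_of_sum_le (s := Finset.univ)
    (f := fun g : 𝒳 → Fin M × Fin S => hashLeakage q g + w * C g) (g := fun _ => A + w * B)
    Finset.univ_nonempty (by
      rw [Finset.sum_add_distrib, ← Finset.mul_sum, Finset.sum_const, nsmul_eq_mul,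
        Finset.card_univ]
      have h3 : w * ∑ g, C g ≤ w * (Fintype.card (𝒳 → Fin M × Fin S) * B) :=
        mul_le_mul_of_nonneg_left h2 hw
      linarith)
  obtain ⟨dec, hdec⟩ := exists_decoder r (fun x => (g x).2)
  refine ⟨g, dec, le_trans (add_le_add le_rfl (mul_le_mul_of_nonneg_left ?_ hw)) hg⟩
  unfold C confusionProb decodingError
  refine Finset.sum_le_sum fun s _ => ?_
  by_cases h : dec s.2 (g s.1).2 ≠ s.1
  · rw [if_pos h, if_pos (hdec s.1 s.2 h)]
  · rw [if_neg h]
    split_ifs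
    exacts [hr.1 s, le_rfl]

end RandomHash

/-! ### Exponents and the asymptotic existence of hash pairs. -/

open Filter Topology

/-- Chernoff's argument: the sum equals 1 at exponent 0 and has derivative `∑ w log c < 0` there. -/
theorem exists_sum_rpow_lt_one {ι : Type*} [Fintype ι] {w c : ι → ℝ} (hw : w ∈ stdSimplex ℝ ι)
    (hc : ∀ i, w i ≠ 0 → 0 < c i) (hneg : ∑ i, w i * Real.log (c i) < 0) :
    ∃ s : ℝ, 0 < s ∧ s ≤ 1 ∧ ∑ i, w i * c i ^ s < 1 := by
  have hd : HasDerivAt (fun s : ℝ => ∑ i, w i * c i ^ s) (∑ i, w i * Real.log (c i)) 0 := by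
    refine HasDerivAt.fun_sum fun i _ => ?_
    by_cases h : w i = 0
    · simpa [h] using hasDerivAt_const (0 : ℝ) (0 : ℝ)
    · simpa using ((Real.hasStrictDerivAt_const_rpow (hc i h) 0).hasDerivAt).const_mul (w i)
  rw [hasDerivAt_iff_tendsto_slope_zero] at hd
  have h1 : ∀ᶠ t in 𝓝[>] (0 : ℝ),
      t⁻¹ • ((∑ i, w i * c i ^ (0 + t)) - ∑ i, w i * c i ^ (0 : ℝ)) < 0 :=
    (hd.eventually_lt_const hneg).filter_mono (nhdsWithin_mono _ fun x hx => ne_of_gt hx)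
  obtain ⟨t, ht, ht0, ht1⟩ := (h1.and (Ioc_mem_nhdsGT (zero_lt_one' ℝ))).exists
  refine ⟨t, ht0, ht1, ?_⟩
  simp only [zero_add, Real.rpow_zero, mul_one, hw.2, smul_eq_mul] at ht
  have := (pos_iff_neg_of_mul_neg ht).1 (inv_pos.2 ht0)
  linarith

section PairIid

variable {A B S : Type*} [Fintype A] [Fintype B] [Fintype S]

/-- The law of the pair of sequences formed by `n` independent pairs of law `Q`. -/
def pairIid {A B : Type*} (Q : A × B → ℝ) (n : ℕ) (s : (Fin n → A) × (Fin n → B)) : ℝ :=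
  ∏ i, Q (s.1 i, s.2 i)

theorem law_iid_pair (P : S → ℝ) (n : ℕ) (f : S → A) (g : S → B) :
    law (iid P n) (fun w => (fun i => f (w i), fun i => g (w i))) =
      pairIid (law P (fun s => (f s, g s))) n := by
  set e := Equiv.arrowProdEquivProdArrow (Fin n) (fun _ => A) (fun _ => B)
  have h := law_law (iid P n) (fun w i => (f (w i), g (w i))) e
  rw [law_iid P n (fun s => (f s, g s))] at h
  refine h.symm.trans ?_
  funext s
  rw [law_equiv]
  rfl

theorem pairIid_eq_law (Q : A × B → ℝ) (n : ℕ) :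
    pairIid Q n = law (iid Q n) (fun w => (fun i => (w i).1, fun i => (w i).2)) := by
  rw [law_iid_pair]
  simp only [Prod.mk.eta, law_id]

theorem pairIid_mem {Q : A × B → ℝ} (hQ : Q ∈ stdSimplex ℝ (A × B)) (n : ℕ) :
    pairIid Q n ∈ stdSimplex ℝ ((Fin n → A) × (Fin n → B)) := by
  rw [pairIid_eq_law]; exact law_mem (iid_mem hQ n) _

theorem law_pairIid_snd (Q : A × B → ℝ) (n : ℕ) :
    law (pairIid Q n) Prod.snd = iid (law Q Prod.snd) n := by
  rw [pairIid_eq_law, law_law, ← law_iid]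

/-- Law and cost both factor over letters; this turns the one-shot bounds into exponential ones. -/
theorem sum_pairIid_rpow (Q c : A × B → ℝ) (hc : ∀ s, 0 ≤ c s) (n : ℕ) (σ : ℝ) :
    ∑ s, pairIid Q n s * (∏ i, c (s.1 i, s.2 i)) ^ σ = (∑ s, Q s * c s ^ σ) ^ n := by
  rw [← (Equiv.arrowProdEquivProdArrow (Fin n) (fun _ => A) (fun _ => B)).sum_comp]
  have := sum_pi_prod (n := n) (fun _ s => Q s * c s ^ σ)
  rw [Finset.prod_const, Finset.card_univ, Fintype.card_fin] at this
  rw [← this]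
  refine Finset.sum_congr rfl fun w _ => ?_
  rw [Finset.prod_mul_distrib, Real.finsetProd_rpow _ _ fun i _ => hc _]
  rfl

/-- The sign of this mean decides the sign of the exponent: it compares the rate `r` with the
conditional entropy `H(A | B)`. -/
theorem sum_mul_log_ratio {Q : A × B → ℝ} (hQ : Q ∈ stdSimplex ℝ (A × B)) (r : ℝ) :
    ∑ s, Q s * Real.log (2 ^ r * (Q s / law Q Prod.snd s.2)) =
      Real.log 2 * (r - (rvEntropy Q id - rvEntropy Q Prod.snd)) := by
  have hl2 : Real.log 2 ≠ 0 := (Real.log_pos one_lt_two).ne'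
  have hid : law Q id = Q := law_id Q
  have hr : r = ∑ s, Q s * r := by rw [← Finset.sum_mul, hQ.2, one_mul]
  conv_rhs => rw [hr]
  rw [rvEntropy_eq, rvEntropy_eq, hid, ← neg_add', sub_neg_eq_add, ← sub_eq_add_neg,
    ← Finset.sum_sub_distrib, ← Finset.sum_add_distrib, Finset.mul_sum]
  refine Finset.sum_congr rfl fun s _ => ?_
  by_cases hs : Q s = 0
  · simp [hs]
  · have h2 := (law_pos hQ.1 Prod.snd hs).ne'
    rw [Real.log_mul (by positivity) (div_ne_zero hs h2), Real.log_div hs h2,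
      Real.log_rpow two_pos, id, Real.logb, Real.logb]
    field_simp

theorem natCeil_le_two_mul {x : ℝ} (hx : 0 ≤ x) : (⌈(2 : ℝ) ^ x⌉₊ : ℝ) ≤ 2 * 2 ^ x := by
  have h1 : (1 : ℝ) ≤ 2 ^ x := Real.one_le_rpow one_le_two hx
  linarith [Nat.ceil_lt_add_one (by linarith : (0 : ℝ) ≤ 2 ^ x)]

/-- The 4 in the hypothesis absorbs rounding up both the key size and the public size, a factor 2
each; it survives as 4 because `σ ≤ 1`. -/
theorem hash_leakage_exponent {Q : A × B → ℝ} (hQ : Q ∈ stdSimplex ℝ (A × B)) {ρ σ : ℝ}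
    (hσ : 0 < σ) (hσ1 : σ ≤ 1) {n N : ℕ} (hN : (N : ℝ) ≤ 4 * 2 ^ (n * ρ)) :
    (N : ℝ) ^ σ / (σ * Real.log 2) *
      (∑ s, pairIid Q n s * (pairIid Q n s / law (pairIid Q n) Prod.snd s.2) ^ σ) ≤
    4 / (σ * Real.log 2) * (∑ s, Q s * (2 ^ ρ * (Q s / law Q Prod.snd s.2)) ^ σ) ^ n := by
  have hl2 : 0 < Real.log 2 := Real.log_pos one_lt_two
  have hq := pairIid_mem hQ n
  have hl := law_nonneg hQ.1 (Prod.snd : A × B → B)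
  have hlq := law_nonneg hq.1 (Prod.snd : (Fin n → A) × (Fin n → B) → _)
  rw [← sum_pairIid_rpow Q _ (fun s => mul_nonneg (by positivity)
    (div_nonneg (hQ.1 s) (hl _))) n σ, div_mul_eq_mul_div, div_mul_eq_mul_div]
  refine div_le_div_of_nonneg_right ?_ (by positivity)
  rw [Finset.mul_sum, Finset.mul_sum]
  refine Finset.sum_le_sum fun s _ => ?_
  rw [mul_left_comm, mul_left_comm (4 : ℝ)]
  refine mul_le_mul_of_nonneg_left ?_ (hq.1 s)
  have e : ∏ i, (2 ^ ρ * (Q (s.1 i, s.2 i) / law Q Prod.snd (s.1 i, s.2 i).2)) =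
      2 ^ (n * ρ) * (pairIid Q n s / law (pairIid Q n) Prod.snd s.2) := by
    rw [Finset.prod_mul_distrib, Finset.prod_div_distrib, law_pairIid_snd, Finset.prod_const,
      Finset.card_univ, Fintype.card_fin, mul_comm (n : ℝ), Real.rpow_mul_natCast two_pos.le]
    rfl
  have hx : 0 ≤ pairIid Q n s / law (pairIid Q n) Prod.snd s.2 := div_nonneg (hq.1 s) (hlq _)
  rw [e, Real.mul_rpow (by positivity) hx, ← mul_assoc]
  refine mul_le_mul_of_nonneg_right ?_ (by positivity)
  calc (N : ℝ) ^ σ ≤ (4 * 2 ^ (n * ρ)) ^ σ := Real.rpow_le_rpow (by positivity) hN hσ.le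
    _ = 4 ^ σ * (2 ^ (n * ρ)) ^ σ := Real.mul_rpow (by norm_num) (by positivity)
    _ ≤ 4 * (2 ^ (n * ρ)) ^ σ := by
        refine mul_le_mul_of_nonneg_right ?_ (by positivity)
        calc (4 : ℝ) ^ σ ≤ 4 ^ (1 : ℝ) := Real.rpow_le_rpow_of_exponent_le (by norm_num) hσ1
          _ = 4 := Real.rpow_one 4

theorem decoding_exponent {Q : A × B → ℝ} (hQ : Q ∈ stdSimplex ℝ (A × B)) {r τ : ℝ}
    (hτ : 0 < τ) {n S : ℕ} (hS : (2 : ℝ) ^ (n * r) ≤ S) :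
    ∑ s, pairIid Q n s * (law (pairIid Q n) Prod.snd s.2 / (S * pairIid Q n s)) ^ τ ≤
      (∑ s, Q s * ((2 ^ r * (Q s / law Q Prod.snd s.2))⁻¹) ^ τ) ^ n := by
  have hq := pairIid_mem hQ n
  have hl := law_nonneg hQ.1 (Prod.snd : A × B → B)
  have hlq := law_nonneg hq.1 (Prod.snd : (Fin n → A) × (Fin n → B) → _)
  rw [← sum_pairIid_rpow Q _ (fun s => inv_nonneg.2 (mul_nonneg (by positivity)
    (div_nonneg (hQ.1 s) (hl _)))) n τ]
  refine Finset.sum_le_sum fun s _ => ?_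
  by_cases hs : pairIid Q n s = 0
  · simp [hs]
  have hs0 : 0 < pairIid Q n s := lt_of_le_of_ne (hq.1 s) (Ne.symm hs)
  have hS0 : (0 : ℝ) < S := lt_of_lt_of_le (by positivity) hS
  have hlq' := hlq s.2
  refine mul_le_mul_of_nonneg_left (Real.rpow_le_rpow (by positivity) ?_ hτ.le) hs0.le
  have e : ∏ i, (2 ^ r * (Q (s.1 i, s.2 i) / law Q Prod.snd (s.1 i, s.2 i).2))⁻¹ =
      (2 ^ (n * r) * (pairIid Q n s / law (pairIid Q n) Prod.snd s.2))⁻¹ := by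
    rw [Finset.prod_inv_distrib, Finset.prod_mul_distrib, Finset.prod_div_distrib,
      law_pairIid_snd, Finset.prod_const,
      Finset.card_univ, Fintype.card_fin, mul_comm (n : ℝ), Real.rpow_mul_natCast two_pos.le]
    rfl
  rw [e, ← mul_div_assoc, inv_div]
  exact div_le_div_of_nonneg_left hlq' (by positivity) (mul_le_mul_of_nonneg_right hS hs0.le)

end PairIid

/-- Asymptotic existence of hash pairs: public rate above `H(X | Y)`, total rate below
`H(X | Z)`. -/
theorem exists_hash_sequence {X Y Z : Type*} [Fintype X] [Fintype Y] [Fintype Z]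
    {Q : X × Z → ℝ} (hQ : Q ∈ stdSimplex ℝ (X × Z)) {V : X × Y → ℝ}
    (hV : V ∈ stdSimplex ℝ (X × Y)) {R : ℝ} (hR : 0 ≤ R)
    (hlt : rvEntropy V id - rvEntropy V Prod.snd + R < rvEntropy Q id - rvEntropy Q Prod.snd) :
    ∃ k : ℕ, ∀ ε : ℝ, 0 < ε → ∀ᶠ n : ℕ in atTop, ∃ m : ℕ, m ≤ n * k ∧
      ∃ (g : (Fin n → X) → Fin ⌈(2 : ℝ) ^ ((n : ℝ) * R)⌉₊ × Fin (2 ^ m))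
        (dec : (Fin n → Y) → Fin (2 ^ m) → (Fin n → X)),
        hashLeakage (pairIid Q n) g ≤ ε ∧
        (n + 1) * decodingError (pairIid V n) (fun x => (g x).2) dec ≤ ε := by
  -- The public hash rate: above `H(X | Y)` for decoding, and below `H(X | Z) - R` for secrecy.
  obtain ⟨r, hr1, hr2⟩ := exists_between (lt_sub_iff_add_lt.2 hlt)
  have hl2 : 0 < Real.log 2 := Real.log_pos one_lt_two
  have hr0 : 0 ≤ r := by
    have := rvEntropy_mono hV.1 (g := Prod.snd) (h := id) (fun a b h => by rw [show a = b from h])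
    linarith
  have : Nonempty X := by
    by_contra h
    rw [not_nonempty_iff] at h
    simpa using hQ.2
  obtain ⟨σ, hσ0, hσ1, hσ⟩ := exists_sum_rpow_lt_one hQ
    (c := fun s => 2 ^ (R + r) * (Q s / law Q Prod.snd s.2))
    (fun s hs => mul_pos (by positivity) (div_pos (lt_of_le_of_ne (hQ.1 s) (Ne.symm hs))
      (law_pos hQ.1 Prod.snd hs)))
    (by rw [sum_mul_log_ratio hQ]; exact mul_neg_of_pos_of_neg hl2 (by linarith))
  obtain ⟨τ, hτ0, hτ1, hτ⟩ := exists_sum_rpow_lt_one hV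
    (c := fun s => (2 ^ r * (V s / law V Prod.snd s.2))⁻¹)
    (fun s hs => inv_pos.2 (mul_pos (by positivity) (div_pos (lt_of_le_of_ne (hV.1 s)
      (Ne.symm hs)) (law_pos hV.1 Prod.snd hs))))
    (by
      simp_rw [Real.log_inv, mul_neg]
      rw [Finset.sum_neg_distrib, sum_mul_log_ratio hV]
      exact neg_neg_of_pos (mul_pos hl2 (by linarith)))
  have hlam0 : 0 ≤ ∑ s, Q s * (2 ^ (R + r) * (Q s / law Q Prod.snd s.2)) ^ σ :=
    Finset.sum_nonneg fun s _ => mul_nonneg (hQ.1 s) (Real.rpow_nonneg (mul_nonneg (by positivity)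
      (div_nonneg (hQ.1 s) (law_nonneg hQ.1 _ _))) _)
  have hmu0 : 0 ≤ ∑ s, V s * ((2 ^ r * (V s / law V Prod.snd s.2))⁻¹) ^ τ :=
    Finset.sum_nonneg fun s _ => mul_nonneg (hV.1 s) (Real.rpow_nonneg (inv_nonneg.2
      (mul_nonneg (by positivity) (div_nonneg (hV.1 s) (law_nonneg hV.1 _ _)))) _)
  set lam := ∑ s, Q s * (2 ^ (R + r) * (Q s / law Q Prod.snd s.2)) ^ σ
  set mu := ∑ s, V s * ((2 ^ r * (V s / law V Prod.snd s.2))⁻¹) ^ τ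
  refine ⟨⌈r⌉₊, fun ε hε => ?_⟩
  -- The weight `n + 1` makes the decoding error `o(1 / n)`, as Fano's inequality with a key of
  -- linear length requires.
  have hlim : Tendsto (fun n : ℕ => 4 / (σ * Real.log 2) * lam ^ n + ((n : ℝ) + 1) * mu ^ n)
      atTop (𝓝 0) := by
    have h1 := (tendsto_pow_atTop_nhds_zero_of_lt_one hlam0 hσ).const_mul (4 / (σ * Real.log 2))
    have h2 := (tendsto_self_mul_const_pow_of_lt_one hmu0 hτ).add
      (tendsto_pow_atTop_nhds_zero_of_lt_one hmu0 hτ)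
    simpa [add_mul] using h1.add h2
  filter_upwards [hlim.eventually_le_const hε] with n hn
  have hnr : 0 ≤ (n : ℝ) * r := by positivity
  have hnR : 0 ≤ (n : ℝ) * R := by positivity
  refine ⟨⌈(n : ℝ) * r⌉₊, ?_, ?_⟩
  · rw [Nat.ceil_le]
    push_cast
    exact mul_le_mul_of_nonneg_left (Nat.le_ceil r) (Nat.cast_nonneg n)
  set m := ⌈(n : ℝ) * r⌉₊ with hm
  have hS1 : (2 : ℝ) ^ ((n : ℝ) * r) ≤ (2 ^ m : ℕ) := by
    push_cast
    rw [← Real.rpow_natCast]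
    exact Real.rpow_le_rpow_of_exponent_le one_le_two (Nat.le_ceil _)
  have hS2 : ((2 ^ m : ℕ) : ℝ) ≤ 2 * 2 ^ ((n : ℝ) * r) := by
    push_cast
    rw [← Real.rpow_natCast, mul_comm, ← Real.rpow_add_one two_ne_zero]
    exact Real.rpow_le_rpow_of_exponent_le one_le_two (Nat.ceil_lt_add_one hnr).le
  have hM := natCeil_le_two_mul hnR
  have hMpos : 0 < ⌈(2 : ℝ) ^ ((n : ℝ) * R)⌉₊ := Nat.ceil_pos.2 (by positivity)
  have hN : ((⌈(2 : ℝ) ^ ((n : ℝ) * R)⌉₊ * 2 ^ m : ℕ) : ℝ) ≤ 4 * 2 ^ ((n : ℝ) * (R + r)) := by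
    rw [Nat.cast_mul, mul_add, Real.rpow_add two_pos]
    calc _ ≤ (2 * 2 ^ ((n : ℝ) * R)) * (2 * 2 ^ ((n : ℝ) * r)) :=
          mul_le_mul hM hS2 (Nat.cast_nonneg _) (by positivity)
      _ = _ := by ring
  obtain ⟨g, dec, h⟩ := exists_hash_pair (pairIid_mem hQ n) (pairIid_mem hV n) hMpos
    (pow_pos two_pos m) hσ0 hσ1 hτ0 hτ1 (w := (n : ℝ) + 1) (by positivity)
  have h1 := hash_leakage_exponent hQ hσ0 hσ1 hN
  have h2 := mul_le_mul_of_nonneg_left (decoding_exponent hV hτ0 hS1)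
    (by positivity : (0 : ℝ) ≤ (n : ℝ) + 1)
  have h3 := hashLeakage_nonneg (pairIid_mem hQ n) g
  have h4 : 0 ≤ ((n : ℝ) + 1) * decodingError (pairIid V n) (fun x => (g x).2) dec :=
    mul_nonneg (by positivity) (decodingError_nonneg (pairIid_mem hV n).1 _ _)
  refine ⟨g, dec, ?_, ?_⟩
  · exact le_trans (le_trans (le_trans (le_add_of_nonneg_right h4) h) (add_le_add h1 h2)) hn
  · exact le_trans (le_trans (le_trans (le_add_of_nonneg_left h3) h) (add_le_add h1 h2)) hn

/-! ### Uniform laws and the uniform reference discussion. -/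

section Uniform

/-- The uniform law on `Fin N`. -/
def unif (N : ℕ) (_ : Fin N) : ℝ := 1 / N

theorem unif_mem {N : ℕ} (hN : 0 < N) : unif N ∈ stdSimplex ℝ (Fin N) := by
  have : (N : ℝ) ≠ 0 := by exact_mod_cast hN.ne'
  exact ⟨fun _ => by unfold unif; positivity, by simp [unif, this]⟩

theorem rvEntropy_unif {N : ℕ} (hN : 0 < N) : rvEntropy (unif N) id = Real.logb 2 N := by
  have h0 : (N : ℝ) ≠ 0 := by exact_mod_cast hN.ne'
  have hid : law (unif N) id = unif N := law_id _
  rw [rvEntropy_eq, hid]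
  simp [unif, h0]

theorem divergence_const_mul {α β γ : Type*} [Fintype α] [Fintype β] [Fintype γ] {p : α → ℝ}
    (hp : p ∈ stdSimplex ℝ α) (f : α → β) (g : α → γ) {c : ℝ} (hc : 0 < c) :
    divergence (law p (fun a => (f a, g a))) (fun s => law p f s.1 * c) =
      ((rvEntropy p f - Real.logb 2 c - rvEntropy p (fun a => (f a, g a)) : ℝ) : EReal) := by
  have e : Real.logb 2 c = ∑ a, p a * Real.logb 2 c := by rw [← Finset.sum_mul, hp.2, one_mul]
  rw [divergence, if_pos, sum_law_mul p (fun a => (f a, g a)), e, rvEntropy_eq, rvEntropy_eq,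
    sub_neg_eq_add, ← neg_add', neg_add_eq_sub, ← Finset.sum_add_distrib,
    ← Finset.sum_sub_distrib]
  · refine congrArg _ (Finset.sum_congr rfl fun a _ => ?_)
    by_cases ha : p a = 0
    · simp [ha]
    · have h1 := (law_pos hp.1 f ha).ne'
      have h3 := (law_pos hp.1 (fun a => (f a, g a)) ha).ne'
      rw [Real.logb_div h3 (mul_ne_zero h1 hc.ne'), Real.logb_mul h1 hc.ne']
      ring
  · intro s hs
    have h := (mul_eq_zero.1 hs).resolve_right hc.ne'
    exact le_antisymm (h ▸ law_mono hp.1 fun a ha => by rw [← ha]) (law_nonneg hp.1 _ _)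

end Uniform

section UniformChannel

variable {X Y Z : Type*} [Fintype X] [Fintype Y] [Fintype Z]

/-- The conceptual channel whose public letter is its input, uniform on `k` bits. -/
def uniformChannel (X Y : Type*) (k : ℕ) : ConceptualChannel X Y k 2 (2 ^ k) where
  pU := unif (2 ^ k)
  pU_mem := unif_mem (by positivity)
  out v _ _ := finFunctionFinEquiv.symm v
  oneSided := Or.inl fun _ _ _ _ => rfl

theorem uniformChannel_letterLaw (P : X × Y × Z → ℝ) (k : ℕ) (z : Z) (f : Fin k → Fin 2) :
    (uniformChannel X Y k).letterLaw P (z, f) = law P (fun s => s.2.2) z * (1 / 2 ^ k) := by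
  classical
  have hk : ∀ v : Fin (2 ^ k), (uniformChannel X Y k).kernel P v (z, f) =
      if v = finFunctionFinEquiv f then law P (fun s => s.2.2) z else 0 := by
    intro v
    have hv : (uniformChannel X Y k).kernel P v =
        law P (fun s => (s.2.2, finFunctionFinEquiv.symm v)) := rfl
    rw [hv]
    split_ifs with h
    · refine law_congr fun s => ?_
      simp [h]
    · unfold law
      refine Finset.sum_eq_zero fun s _ => if_neg fun h' => h ?_
      rw [← (Prod.mk.inj h').2, Equiv.apply_symm_apply]
  unfold ConceptualChannel.letterLaw
  simp_rw [hk]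
  simp [uniformChannel, unif]

theorem uniformChannel_meaningless {P : X × Y × Z → ℝ} (hP : P ∈ stdSimplex ℝ (X × Y × Z))
    (k : ℕ) : (uniformChannel X Y k).Meaningless P := by
  classical
  intro z f
  have h : law ((uniformChannel X Y k).letterLaw P) Prod.snd f = 1 / 2 ^ k := by
    unfold law
    rw [Fintype.sum_prod_type]
    simp only [Finset.sum_ite_eq', Finset.mem_univ, if_true, uniformChannel_letterLaw]
    rw [← Finset.sum_mul, sum_law, hP.2, one_mul]
  rw [h, uniformChannel_letterLaw]

theorem uniformChannel_target (P : X × Y × Z → ℝ) (k n : ℕ) :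
    (uniformChannel X Y k).target P n =
      fun s => iid (law P (fun s => s.2.2)) n s.1 * (1 / 2 ^ (n * k)) := by
  funext s
  rw [ConceptualChannel.target_eq]
  simp only [uniformChannel_letterLaw, Finset.prod_mul_distrib, iid]
  simp [← pow_mul, mul_comm]

end UniformChannel

/-! ### Effective secrecy of a hashed and padded discussion. -/

namespace Protocol

variable {X Y Z 𝒳 : Type*} [Fintype X] [Fintype Y] [Fintype Z] [Fintype 𝒳] {n k M S T : ℕ}

/-- The marginal of `Zⁿ` agrees exactly with the reference, so non-stealth is the entropy deficit `n
k - H(F | Zⁿ)`. -/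
theorem nonStealth_uniformChannel (c : Protocol X Y n k 2 M) {P : X × Y × Z → ℝ}
    (hP : P ∈ stdSimplex ℝ (X × Y × Z)) :
    c.nonStealth P (uniformChannel X Y k) =
      ((rvEntropy (c.prob P) (fun w i => (w.1 i).2.2) + n * k -
        rvEntropy (c.prob P) c.wardenView : ℝ) : EReal) := by
  have hZ : law (c.prob P) (fun w i => (w.1 i).2.2) = iid (law P (fun s => s.2.2)) n := by
    rw [prob_eq, ← law_iid]
    exact law_prodLaw_fst (iid P n) (prodLaw_mem c.pA_mem c.pB_mem).2
      (fun v i => (v i).2.2)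
  have h := divergence_const_mul (c.prob_mem hP) (fun (w : c.Sample Z) i => (w.1 i).2.2)
    c.discussion (c := 1 / 2 ^ (n * k)) (by positivity)
  rw [hZ] at h
  unfold nonStealth
  rw [uniformChannel_target]
  refine h.trans ?_
  have : Real.logb 2 (1 / 2 ^ (n * k)) = -(n * k) := by
    rw [one_div, Real.logb_inv, Real.logb_pow, Real.logb_self_eq_one one_lt_two]
    simp
  rw [this, sub_neg_eq_add]
  rfl

/-- Secrecy of a key in a protocol whose discussion consists of a hash of the speaker's sequence
and uniform padding; `g` provides the hash and the key of the speaker. -/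
theorem hash_protocol_secrecy (c : Protocol X Y n k 2 M) {P : X × Y × Z → ℝ}
    (hP : P ∈ stdSimplex ℝ (X × Y × Z)) {q : 𝒳 × (Fin n → Z) → ℝ}
    (hq : q ∈ stdSimplex ℝ (𝒳 × (Fin n → Z))) (g : 𝒳 → Fin M × Fin S)
    (e : Fin S × Fin T ≃ (Fin n → Fin k → Fin 2)) (hT : 0 < T)
    (x : c.Sample Z → 𝒳) (ρ : c.Sample Z → Fin T)
    (hF : ∀ w : c.Sample Z, c.discussion w = e ((g (x w)).2, ρ w))
    (hlaw : law (c.prob P) (fun w => ((x w, fun i => (w.1 i).2.2), ρ w)) = prodLaw q (unif T)) :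
    c.nonUniformity P ≤ hashLeakage q g +
        (rvEntropy (c.prob P) (fun w => ((g (x w)).1, c.key w)) -
          rvEntropy (c.prob P) c.key) ∧
      c.nonConfusion P + c.nonStealth P (uniformChannel X Y k) ≤
        ((hashLeakage q g + (rvEntropy (c.prob P) (fun w => (c.key w, (g (x w)).1)) -
          rvEntropy (c.prob P) (fun w => (g (x w)).1)) : ℝ) : EReal) := by
  have hp := c.prob_mem hP
  set κ : c.Sample Z → Fin M := fun w => (g (x w)).1 with hκ
  have hlq : law (c.prob P) (fun w => (x w, fun i => (w.1 i).2.2)) = q := by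
    have := law_law (c.prob P) (fun w : c.Sample Z => ((x w, fun i => (w.1 i).2.2), ρ w)) Prod.fst
    rw [hlaw] at this
    exact this.symm.trans ((law_prodLaw_fst q (unif_mem hT).2 (fun s => s)).trans (law_id q))
  have hcard : S * T = 2 ^ (n * k) := by
    have := Fintype.card_congr e
    simpa [← pow_mul, mul_comm] using this
  have hS : (S : ℝ) ≠ 0 := by
    have : S ≠ 0 := fun h => by
      rw [h, zero_mul] at hcard
      exact (by positivity : 2 ^ (n * k) ≠ 0) hcard.symm
    exact_mod_cast this
  have hT' : (T : ℝ) ≠ 0 := by exact_mod_cast hT.ne'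
  have hM : (M : ℝ) ≠ 0 := by
    have hne : Nonempty (c.Sample Z) := by
      by_contra h
      rw [not_nonempty_iff] at h
      simpa using hp.2
    have : M ≠ 0 := fun h => by
      have a := c.key hne.some
      rw [h] at a
      exact a.elim0
    exact_mod_cast this
  have hlogST : Real.logb 2 S + Real.logb 2 T = n * k := by
    rw [← Real.logb_mul hS hT', ← Nat.cast_mul, hcard]
    push_cast
    rw [Real.logb_pow, Real.logb_self_eq_one one_lt_two]
    simp
  -- The discussion is a bijective encoding of public hash and padding, and the padding is uniform
  -- and independent of the rest.
  have hV : rvEntropy (c.prob P) (fun w => (κ w, c.wardenView w)) =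
      rvEntropy q (fun s => (g s.1, s.2)) + Real.logb 2 T := by
    rw [← rvEntropy_unif hT, ← rvEntropy_prodLaw hq (unif_mem hT), ← hlaw, rvEntropy_law]
    refine rvEntropy_congr fun v w => ?_
    simp only [hκ, wardenView, hF, Prod.mk.injEq, EmbeddingLike.apply_eq_iff_eq, id,
      Prod.ext_iff (x := g (x v))]
    tauto
  have hZ : rvEntropy q Prod.snd = rvEntropy (c.prob P) (fun w i => (w.1 i).2.2) := by
    rw [← hlq, rvEntropy_law]
  have hleak : hashLeakage q g = Real.logb 2 M + n * k +
      rvEntropy (c.prob P) (fun w i => (w.1 i).2.2) -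
        rvEntropy (c.prob P) (fun w => (κ w, c.wardenView w)) := by
    rw [hashLeakage, Fintype.card_prod, Fintype.card_fin, Fintype.card_fin, Nat.cast_mul,
      Real.logb_mul hM hS, hV, hZ]
    linarith
  have hmono : rvEntropy (c.prob P) κ ≤ rvEntropy (c.prob P) (fun w => (κ w, c.key w)) :=
    rvEntropy_mono hp.1 fun v w h => (Prod.mk.inj h).1
  have hsymm : rvEntropy (c.prob P) (fun w => (κ w, c.key w)) =
      rvEntropy (c.prob P) (fun w => (c.key w, κ w)) :=
    rvEntropy_congr fun v w => by simp only [Prod.mk.injEq]; tauto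
  have hκM : rvEntropy (c.prob P) κ ≤ Real.logb 2 M := by
    simpa using rvEntropy_le_logb_card hp κ
  constructor
  · have hsub := rvEntropy_submodular hp.1 (f₁ := κ)
      (f₂ := fun w => (fun i => (w.1 i).2.2, c.discussion w))
      (f₁₂ := fun w => (κ w, c.wardenView w)) (f₀ := fun _ => ())
      (fun v w h1 h2 => Prod.ext h1 h2) (fun _ _ _ => rfl) (fun _ _ _ => rfl)
    have hsub2 := rvEntropy_submodular hp.1 (f₁ := fun (w : c.Sample Z) i => (w.1 i).2.2)
      (f₂ := c.discussion)
      (f₁₂ := fun w => (fun i => (w.1 i).2.2, c.discussion w)) (f₀ := fun _ => ())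
      (fun v w h1 h2 => Prod.ext h1 h2) (fun _ _ _ => rfl) (fun _ _ _ => rfl)
    have hF' := rvEntropy_le_logb_card hp c.discussion
    rw [← Fintype.card_congr e, Fintype.card_prod, Fintype.card_fin, Fintype.card_fin,
      Nat.cast_mul, Real.logb_mul hS hT', hlogST] at hF'
    rw [rvEntropy_const hp (g := fun _ => ()) (fun _ _ => rfl)] at hsub hsub2
    change Real.logb 2 M - rvEntropy (c.prob P) c.key ≤ _
    linarith
  -- In the sum of the two divergences the entropy of the warden's view cancels. Exchanging `K` for
  -- the speaker's key `κ` then costs at most `H(K | κ)`.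
  · have hsub := rvEntropy_submodular hp.1 (f₁ := fun w => (c.key w, κ w))
      (f₂ := fun w => (c.key w, c.wardenView w)) (f₁₂ := fun w => (κ w, c.wardenView w))
      (f₀ := c.key)
      (fun v w h1 h2 => Prod.ext (Prod.mk.inj h1).2 (Prod.mk.inj h2).2)
      (fun v w h => (Prod.mk.inj h).1) (fun v w h => (Prod.mk.inj h).1)
    rw [c.nonConfusion_eq hP, c.nonStealth_uniformChannel hP, ← EReal.coe_add,
      EReal.coe_le_coe_iff]
    linarith

end Protocol

/-! ### One-way protocols of Alice and of Bob. -/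

section Schemes

variable {X Y Z : Type*} {n k M S T : ℕ}

/-- The symbol with number `t` of a public discussion. -/
def symbolAt (f : Fin n → Fin k → Fin 2) (t : ℕ) : Fin 2 :=
  -- Symbols are indexed by all naturals, but only those numbered below `n * k` enter the
  -- discussion; the default is immaterial.
  if h : t / k < n ∧ t % k < k then f ⟨t / k, h.1⟩ ⟨t % k, h.2⟩ else 0

theorem symbolAt_mul_add (f : Fin n → Fin k → Fin 2) (i : Fin n) (j : Fin k) :
    symbolAt f (i * k + j) = f i j := by
  have hk : 0 < k := j.pos
  have h1 : (i * k + j : ℕ) / k = i := by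
    rw [mul_comm, Nat.mul_add_div hk, Nat.div_eq_of_lt j.isLt, add_zero]
  have h2 : (i * k + j : ℕ) % k = j := by
    rw [mul_comm, Nat.mul_add_mod, Nat.mod_eq_of_lt j.isLt]
  unfold symbolAt
  rw [dif_pos (by rw [h1, h2]; exact ⟨i.isLt, j.isLt⟩)]
  simp only [h1, h2]

/-- One-way protocol in which Alice sends a hash of her sequence and uniform padding. -/
def aliceProtocol (hT : 0 < T) (g : (Fin n → X) → Fin M × Fin S)
    (dec : (Fin n → Y) → Fin S → (Fin n → X)) (e : Fin S × Fin T ≃ (Fin n → Fin k → Fin 2)) :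
    Protocol X Y n k 2 M where
  randA := T
  randB := 1
  pA := unif T
  pB := unif 1
  pA_mem := unif_mem hT
  pB_mem := unif_mem one_pos
  aliceSpeaks _ := true
  msgA t x ra _ := symbolAt (e ((g x).2, ra)) t
  msgB _ _ _ _ := 0
  keyA x _ _ := (g x).1
  keyB y _ f := (g (dec y (e.symm f).1)).1

/-- One-way protocol in which Bob sends a hash of his sequence and uniform padding. -/
def bobProtocol (hT : 0 < T) (g : (Fin n → Y) → Fin M × Fin S)
    (dec : (Fin n → X) → Fin S → (Fin n → Y)) (e : Fin S × Fin T ≃ (Fin n → Fin k → Fin 2)) :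
    Protocol X Y n k 2 M where
  randA := 1
  randB := T
  pA := unif 1
  pB := unif T
  pA_mem := unif_mem one_pos
  pB_mem := unif_mem hT
  aliceSpeaks _ := false
  msgA _ _ _ _ := 0
  msgB t y rb _ := symbolAt (e ((g y).2, rb)) t
  keyA x _ f := (g (dec x (e.symm f).1)).1
  keyB y _ _ := (g y).1

theorem aliceProtocol_discussion (hT : 0 < T) (g : (Fin n → X) → Fin M × Fin S)
    (dec : (Fin n → Y) → Fin S → (Fin n → X)) (e : Fin S × Fin T ≃ (Fin n → Fin k → Fin 2))
    (w : (aliceProtocol hT g dec e).Sample Z) :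
    (aliceProtocol hT g dec e).discussion w = e ((g fun i => (w.1 i).1).2, w.2.1) := by
  funext i j
  rw [Protocol.discussion, Protocol.symbol]
  simp only [aliceProtocol, if_true]
  exact symbolAt_mul_add _ i j

theorem bobProtocol_discussion (hT : 0 < T) (g : (Fin n → Y) → Fin M × Fin S)
    (dec : (Fin n → X) → Fin S → (Fin n → Y)) (e : Fin S × Fin T ≃ (Fin n → Fin k → Fin 2))
    (w : (bobProtocol hT g dec e).Sample Z) :
    (bobProtocol hT g dec e).discussion w = e ((g fun i => (w.1 i).2.1).2, w.2.2) := by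
  funext i j
  rw [Protocol.discussion, Protocol.symbol]
  simp only [bobProtocol, Bool.false_eq_true, if_false]
  exact symbolAt_mul_add _ i j

variable [Fintype X] [Fintype Y] [Fintype Z]

theorem aliceProtocol_law (hT : 0 < T) (g : (Fin n → X) → Fin M × Fin S)
    (dec : (Fin n → Y) → Fin S → (Fin n → X)) (e : Fin S × Fin T ≃ (Fin n → Fin k → Fin 2))
    (P : X × Y × Z → ℝ) :
    law ((aliceProtocol hT g dec e).prob P)
      (fun w => ((fun i => (w.1 i).1, fun i => (w.1 i).2.2), w.2.1)) =
      prodLaw (pairIid (law P (fun s => (s.1, s.2.2))) n) (unif T) := by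
  have h1 := law_prodLaw_fst (unif T) (unif_mem one_pos).2 (fun s => s)
  rw [law_id] at h1
  rw [← law_iid_pair, ← h1, ← law_prodLaw]
  rfl

theorem bobProtocol_law (hT : 0 < T) (g : (Fin n → Y) → Fin M × Fin S)
    (dec : (Fin n → X) → Fin S → (Fin n → Y)) (e : Fin S × Fin T ≃ (Fin n → Fin k → Fin 2))
    (P : X × Y × Z → ℝ) :
    law ((bobProtocol hT g dec e).prob P)
      (fun w => ((fun i => (w.1 i).2.1, fun i => (w.1 i).2.2), w.2.2)) =
      prodLaw (pairIid (law P (fun s => (s.2.1, s.2.2))) n) (unif T) := by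
  have h1 := law_prodLaw_snd (unif_mem one_pos).2 (unif T) (fun s => s)
  rw [law_id] at h1
  rw [← law_iid_pair, ← h1, ← law_prodLaw]
  rfl

/-- When Bob decodes Alice's sequence correctly he applies the same hash to it, so keys differ only
on decoding errors. -/
theorem aliceProtocol_errorProb_le (hT : 0 < T) (g : (Fin n → X) → Fin M × Fin S)
    (dec : (Fin n → Y) → Fin S → (Fin n → X)) (e : Fin S × Fin T ≃ (Fin n → Fin k → Fin 2))
    {P : X × Y × Z → ℝ} (hP : P ∈ stdSimplex ℝ (X × Y × Z)) :
    (aliceProtocol hT g dec e).errorProb P ≤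
      decodingError (pairIid (law P (fun s => (s.1, s.2.1))) n) (fun x => (g x).2) dec := by
  classical
  set c := aliceProtocol hT g dec e with hc
  have hp := c.prob_mem hP
  have hl : law (c.prob P) (fun w => (fun i => (w.1 i).1, fun i => (w.1 i).2.1)) =
      pairIid (law P (fun s => (s.1, s.2.1))) n := by
    rw [← law_iid_pair, Protocol.prob_eq]
    exact law_prodLaw_fst (iid P n) (prodLaw_mem c.pA_mem c.pB_mem).2
      (fun v => (fun i => (v i).1, fun i => (v i).2.1))
  have hs := sum_law_mul (c.prob P) (fun w => (fun i => (w.1 i).1, fun i => (w.1 i).2.1))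
    (fun s => if dec s.2 (g s.1).2 ≠ s.1 then (1 : ℝ) else 0)
  rw [hl] at hs
  have hd : decodingError (pairIid (law P (fun s => (s.1, s.2.1))) n) (fun x => (g x).2) dec =
      ∑ s, pairIid (law P (fun s => (s.1, s.2.1))) n s *
        (if dec s.2 (g s.1).2 ≠ s.1 then (1 : ℝ) else 0) :=
    Finset.sum_congr rfl fun s _ => by
      by_cases h : dec s.2 (g s.1).2 ≠ s.1
      · rw [if_pos h, if_pos h, mul_one]
      · rw [if_neg h, if_neg h, mul_zero]
  rw [hd, hs]
  refine Finset.sum_le_sum fun w _ => ?_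
  by_cases h : dec (fun i => (w.1 i).2.1) (g fun i => (w.1 i).1).2 ≠ fun i => (w.1 i).1
  · rw [if_pos h, mul_one]
    split_ifs
    exacts [le_rfl, hp.1 w]
  · rw [if_neg h, mul_zero, if_neg]
    rw [not_not] at h ⊢
    have hd := aliceProtocol_discussion hT g dec e w
    change (g fun i => (w.1 i).1).1 =
      (g (dec (fun i => (w.1 i).2.1) (e.symm (c.discussion w)).1)).1
    rw [show c.discussion w = _ from hd, Equiv.symm_apply_apply, h]

theorem bobProtocol_errorProb_le (hT : 0 < T) (g : (Fin n → Y) → Fin M × Fin S)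
    (dec : (Fin n → X) → Fin S → (Fin n → Y)) (e : Fin S × Fin T ≃ (Fin n → Fin k → Fin 2))
    {P : X × Y × Z → ℝ} (hP : P ∈ stdSimplex ℝ (X × Y × Z)) :
    (bobProtocol hT g dec e).errorProb P ≤
      decodingError (pairIid (law P (fun s => (s.2.1, s.1))) n) (fun x => (g x).2) dec := by
  classical
  set c := bobProtocol hT g dec e with hc
  have hp := c.prob_mem hP
  have hl : law (c.prob P) (fun w => (fun i => (w.1 i).2.1, fun i => (w.1 i).1)) =
      pairIid (law P (fun s => (s.2.1, s.1))) n := by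
    rw [← law_iid_pair, Protocol.prob_eq]
    exact law_prodLaw_fst (iid P n) (prodLaw_mem c.pA_mem c.pB_mem).2
      (fun v => (fun i => (v i).2.1, fun i => (v i).1))
  have hs := sum_law_mul (c.prob P) (fun w => (fun i => (w.1 i).2.1, fun i => (w.1 i).1))
    (fun s => if dec s.2 (g s.1).2 ≠ s.1 then (1 : ℝ) else 0)
  rw [hl] at hs
  have hd : decodingError (pairIid (law P (fun s => (s.2.1, s.1))) n) (fun x => (g x).2) dec =
      ∑ s, pairIid (law P (fun s => (s.2.1, s.1))) n s *
        (if dec s.2 (g s.1).2 ≠ s.1 then (1 : ℝ) else 0) :=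
    Finset.sum_congr rfl fun s _ => by
      by_cases h : dec s.2 (g s.1).2 ≠ s.1
      · rw [if_pos h, if_pos h, mul_one]
      · rw [if_neg h, if_neg h, mul_zero]
  rw [hd, hs]
  refine Finset.sum_le_sum fun w _ => ?_
  by_cases h : dec (fun i => (w.1 i).1) (g fun i => (w.1 i).2.1).2 ≠ fun i => (w.1 i).2.1
  · rw [if_pos h, mul_one]
    split_ifs
    exacts [le_rfl, hp.1 w]
  · rw [if_neg h, mul_zero, if_neg]
    rw [not_not] at h ⊢
    have hd := bobProtocol_discussion hT g dec e w
    change (g (dec (fun i => (w.1 i).1) (e.symm (c.discussion w)).1)).1 =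
      (g fun i => (w.1 i).2.1).1
    rw [show c.discussion w = _ from hd, Equiv.symm_apply_apply, h]

end Schemes

/-! ### Achievable rates and the lower bound. -/

section Achievability

variable {X Y Z : Type*} [Fintype X] [Fintype Y] [Fintype Z]

theorem nonempty_discussion_equiv {n k m : ℕ} (hm : m ≤ n * k) :
    Nonempty (Fin (2 ^ m) × Fin (2 ^ (n * k - m)) ≃ (Fin n → Fin k → Fin 2)) := by
  refine Fintype.card_eq.1 ?_
  simp [← pow_mul, ← pow_add, Nat.add_sub_cancel' hm, mul_comm]

/-- A one-element key and an empty discussion. This covers the case of a nonpositive lower bound. -/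
theorem achievable_zero {P : X × Y × Z → ℝ} (hP : P ∈ stdSimplex ℝ (X × Y × Z)) :
    Achievable P 0 := by
  refine ⟨le_rfl, 0, 2, 2 ^ 0, uniformChannel X Y 0, uniformChannel_meaningless hP 0,
    fun ε hε => Filter.Eventually.of_forall fun n => ?_⟩
  have hM : ⌈(2 : ℝ) ^ ((n : ℝ) * 0)⌉₊ = 1 := by simp
  rw [hM]
  obtain ⟨e⟩ := nonempty_discussion_equiv (n := n) (k := 0) (m := 0) (Nat.zero_le _)
  have hne : Nonempty X := by
    by_contra h
    rw [not_nonempty_iff] at h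
    simpa using hP.2
  set g : (Fin n → X) → Fin 1 × Fin (2 ^ 0) := fun _ => (0, 0) with hg
  set c : Protocol X Y n 0 2 1 :=
    aliceProtocol (pow_pos two_pos _) g (fun _ _ _ => hne.some) e with hc
  have hq := pairIid_mem (law_mem hP (fun s => (s.1, s.2.2))) n
  obtain ⟨h1, h2⟩ := c.hash_protocol_secrecy hP hq g e (pow_pos two_pos _)
    (fun w i => (w.1 i).1) (fun w => w.2.1)
    (fun w => aliceProtocol_discussion _ _ _ _ w) (aliceProtocol_law _ _ _ _ P)
  have hp := c.prob_mem hP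
  have e0 : hashLeakage (pairIid (law P (fun s => (s.1, s.2.2))) n) g = 0 := by
    have : rvEntropy (pairIid (law P (fun s => (s.1, s.2.2))) n) Prod.snd =
        rvEntropy (pairIid (law P (fun s => (s.1, s.2.2))) n) (fun s => (g s.1, s.2)) :=
      rvEntropy_congr fun v w => by simp [hg]
    rw [hashLeakage, this]
    simp
  have hsub : ∀ a b : Fin 1, a = b := fun a b => Subsingleton.elim a b
  rw [e0, rvEntropy_const hp (fun v w => Prod.ext (hsub _ _) (hsub _ _)),
    rvEntropy_const hp (fun v w => hsub _ _)] at h1 h2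
  refine ⟨c, ?_, by linarith, h2.trans (by simpa using hε.le)⟩
  have : c.errorProb P = 0 := Finset.sum_eq_zero fun w _ => if_neg (not_not.2 (hsub _ _))
  rw [this]
  exact hε.le

/-- The bound in Fano's inequality is small when the error probability is `o(1 / n)`. -/
theorem exists_fano_constants {R ε : ℝ} (hR : 0 ≤ R) (hε : 0 < ε) :
    ∃ e η : ℝ, 0 < e ∧ e < 1 ∧ 0 < η ∧ η ≤ ε ∧ ∀ (n : ℕ) (x : ℝ), 0 ≤ x → (n + 1) * x ≤ η →
      -Real.logb 2 (1 - e) + x * (Real.logb 2 (1 / e) + (n * R + 1)) ≤ ε := by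
  have h1 : (2 : ℝ) ^ (-(ε / 2)) < 1 :=
    Real.rpow_lt_one_of_one_lt_of_neg one_lt_two (by linarith)
  have h0 : (0 : ℝ) < 2 ^ (-(ε / 2)) := by positivity
  -- Chosen so that `-logb 2 (1 - e) = ε / 2`; the other half of `ε` is left for the term
  -- proportional to the error.
  set e : ℝ := 1 - 2 ^ (-(ε / 2)) with he
  have he0 : 0 < e := by linarith
  have he1 : e < 1 := by linarith
  set L := Real.logb 2 (1 / e) with hL
  have hL0 : 0 ≤ L := Real.logb_nonneg one_lt_two (by rw [le_div_iff₀ he0]; linarith)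
  have hD : 0 < L + R + 1 := by linarith
  refine ⟨e, min ε (ε / 2 / (L + R + 1)), he0, he1, lt_min hε (by positivity), min_le_left _ _,
    fun n x hx hn => ?_⟩
  have h2 : Real.logb 2 (1 - e) = -(ε / 2) := by
    rw [he, sub_sub_cancel, Real.logb_rpow two_pos (by norm_num)]
  have h3 : (n + 1) * x * (L + R + 1) ≤ ε / 2 :=
    (le_div_iff₀ hD).1 (hn.trans (min_le_right _ _))
  have hn0 : (0 : ℝ) ≤ n := Nat.cast_nonneg n
  have h4 : L + (n * R + 1) ≤ (n + 1) * (L + R + 1) := by nlinarith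
  have h5 := mul_le_mul_of_nonneg_left h4 hx
  rw [h2]
  linarith

/-- A protocol with a hashed discussion satisfies all constraints once the leakage of the hash and
the disagreement between the key and the speaker's key are small. -/
theorem Protocol.hash_protocol_bounds {n k S T : ℕ} {R ε e η : ℝ} (hR : 0 ≤ R) (he0 : 0 < e)
    (he1 : e < 1)
    (hfano : ∀ (n : ℕ) (x : ℝ), 0 ≤ x → (n + 1) * x ≤ η →
      -Real.logb 2 (1 - e) + x * (Real.logb 2 (1 / e) + (n * R + 1)) ≤ ε)
    (c : Protocol X Y n k 2 ⌈(2 : ℝ) ^ ((n : ℝ) * R)⌉₊) {P : X × Y × Z → ℝ}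
    (hP : P ∈ stdSimplex ℝ (X × Y × Z)) {𝒳 : Type*} [Fintype 𝒳] {q : 𝒳 × (Fin n → Z) → ℝ}
    (hq : q ∈ stdSimplex ℝ (𝒳 × (Fin n → Z)))
    (g : 𝒳 → Fin ⌈(2 : ℝ) ^ ((n : ℝ) * R)⌉₊ × Fin S)
    (f : Fin S × Fin T ≃ (Fin n → Fin k → Fin 2)) (hT : 0 < T)
    (x : c.Sample Z → 𝒳) (ρ : c.Sample Z → Fin T)
    (hF : ∀ w : c.Sample Z, c.discussion w = f ((g (x w)).2, ρ w))
    (hlaw : law (c.prob P) (fun w => ((x w, fun i => (w.1 i).2.2), ρ w)) = prodLaw q (unif T))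
    (herr : (n + 1) * (∑ w, if c.key w ≠ (g (x w)).1 then c.prob P w else 0) ≤ η) :
    c.nonUniformity P ≤ hashLeakage q g + ε ∧
      c.nonConfusion P + c.nonStealth P (uniformChannel X Y k) ≤
        ((hashLeakage q g + ε : ℝ) : EReal) := by
  have hp := c.prob_mem hP
  obtain ⟨h1, h2⟩ := c.hash_protocol_secrecy hP hq g f hT x ρ hF hlaw
  set κ : c.Sample Z → Fin ⌈(2 : ℝ) ^ ((n : ℝ) * R)⌉₊ := fun w => (g (x w)).1 with hκ
  set x := ∑ w, if c.key w ≠ κ w then c.prob P w else 0 with hx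
  have hx0 : 0 ≤ x := Finset.sum_nonneg fun w _ => by
    split_ifs; exacts [hp.1 w, le_rfl]
  have hx' : (∑ w, if κ w ≠ c.key w then c.prob P w else 0) = x :=
    Finset.sum_congr rfl fun w _ => by simp only [ne_comm]
  have hM := logb_natCeil_le (mul_nonneg (Nat.cast_nonneg n) hR)
  have hb : -Real.logb 2 (1 - e) + x * (Real.logb 2 (1 / e) +
      Real.logb 2 (Fintype.card (Fin ⌈(2 : ℝ) ^ ((n : ℝ) * R)⌉₊))) ≤ ε := by
    refine le_trans ?_ (hfano n x hx0 herr)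
    rw [Fintype.card_fin]
    gcongr
  -- Both directions are needed: `H(K | κ)` for secrecy and `H(κ | K)` for uniformity.
  have f1 := (rvEntropy_fano hp c.key κ he0 he1).trans hb
  have f2 := rvEntropy_fano hp κ c.key he0 he1
  rw [hx'] at f2
  refine ⟨h1.trans (add_le_add le_rfl (f2.trans hb)), h2.trans ?_⟩
  exact_mod_cast add_le_add le_rfl f1

/-- Rates below `I(X; Y) - I(X; Z)` are achieved by a one-way protocol of Alice. -/
theorem achievable_of_alice {P : X × Y × Z → ℝ} (hP : P ∈ stdSimplex ℝ (X × Y × Z)) {R : ℝ}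
    (hR : 0 ≤ R) (hlt : R < mutualInfo (law P (fun s => (s.1, s.2.1))) -
      mutualInfo (law P (fun s => (s.1, s.2.2)))) : Achievable P R := by
  rw [mutualInfo_law hP.1, mutualInfo_law hP.1] at hlt
  have hQ := law_mem hP (fun s => (s.1, s.2.2))
  have hV := law_mem hP (fun s => (s.1, s.2.1))
  obtain ⟨k, hk⟩ := exists_hash_sequence hQ hV hR (by
    simp only [rvEntropy_law, id]
    linarith)
  refine ⟨hR, k, 2, 2 ^ k, uniformChannel X Y k, uniformChannel_meaningless hP k, fun ε hε => ?_⟩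
  obtain ⟨e, η, he0, he1, hη0, hηε, hfano⟩ := exists_fano_constants hR (half_pos hε)
  filter_upwards [hk η hη0] with n hn
  obtain ⟨m, hm, g, dec, hleak, hdec⟩ := hn
  obtain ⟨f⟩ := nonempty_discussion_equiv hm
  have hT : 0 < 2 ^ (n * k - m) := by positivity
  have herr := aliceProtocol_errorProb_le hT g dec f hP
  have hdec0 := decodingError_nonneg (pairIid_mem hV n).1 (fun x => (g x).2) dec
  have hn0 : (0 : ℝ) ≤ n := Nat.cast_nonneg n
  obtain ⟨h1, h2⟩ := (aliceProtocol hT g dec f).hash_protocol_bounds hR he0 he1 hfano hP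
    (pairIid_mem hQ n) g f hT (fun w i => (w.1 i).1) (fun w => w.2.1)
    (fun w => aliceProtocol_discussion hT g dec f w) (aliceProtocol_law hT g dec f P)
    -- Alice's key is exactly the speaker's key, so there is no disagreement to bound.
    (le_of_eq_of_le (mul_eq_zero_of_right _
      (Finset.sum_eq_zero fun w _ => if_neg (not_not.2 rfl))) hη0.le)
  refine ⟨aliceProtocol hT g dec f, by nlinarith, by linarith, h2.trans ?_⟩
  exact_mod_cast (by linarith)

/-- Rates below `I(Y; X) - I(Y; Z)` are achieved by a one-way protocol of Bob. -/
theorem achievable_of_bob {P : X × Y × Z → ℝ} (hP : P ∈ stdSimplex ℝ (X × Y × Z)) {R : ℝ}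
    (hR : 0 ≤ R) (hlt : R < mutualInfo (law P (fun s => (s.2.1, s.1))) -
      mutualInfo (law P (fun s => (s.2.1, s.2.2)))) : Achievable P R := by
  rw [mutualInfo_law hP.1, mutualInfo_law hP.1] at hlt
  have hQ := law_mem hP (fun s => (s.2.1, s.2.2))
  have hV := law_mem hP (fun s => (s.2.1, s.1))
  obtain ⟨k, hk⟩ := exists_hash_sequence hQ hV hR (by
    simp only [rvEntropy_law, id]
    linarith)
  refine ⟨hR, k, 2, 2 ^ k, uniformChannel X Y k, uniformChannel_meaningless hP k, fun ε hε => ?_⟩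
  obtain ⟨e, η, he0, he1, hη0, hηε, hfano⟩ := exists_fano_constants hR (half_pos hε)
  filter_upwards [hk η hη0] with n hn
  obtain ⟨m, hm, g, dec, hleak, hdec⟩ := hn
  obtain ⟨f⟩ := nonempty_discussion_equiv hm
  have hT : 0 < 2 ^ (n * k - m) := by positivity
  have herr := bobProtocol_errorProb_le hT g dec f hP
  have hdec0 := decodingError_nonneg (pairIid_mem hV n).1 (fun x => (g x).2) dec
  have hn0 : (0 : ℝ) ≤ n := Nat.cast_nonneg n
  obtain ⟨h1, h2⟩ := (bobProtocol hT g dec f).hash_protocol_bounds hR he0 he1 hfano hP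
    (pairIid_mem hQ n) g f hT (fun w i => (w.1 i).2.1) (fun w => w.2.2)
    (fun w => bobProtocol_discussion hT g dec f w) (bobProtocol_law hT g dec f P)
    -- Here `K` is the listener's decoded key, and it disagrees with the speaker's key exactly when
    -- the protocol errs.
    ((mul_le_mul_of_nonneg_left herr (by positivity)).trans hdec)
  refine ⟨bobProtocol hT g dec f, by nlinarith, by linarith, h2.trans ?_⟩
  exact_mod_cast (by linarith)

/-- A real number strictly between the capacity and `L` would be nonnegative, since rate 0 is
achievable, and hence itself an achievable rate. -/
theorem le_capacity {P : X × Y × Z → ℝ} (hP : P ∈ stdSimplex ℝ (X × Y × Z)) {L : ℝ}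
    (h : ∀ R, 0 ≤ R → R < L → Achievable P R) : (L : EReal) ≤ capacity P := by
  have hle : ∀ R, Achievable P R → (R : EReal) ≤ capacity P := fun R hR =>
    le_sSup (Set.mem_image_of_mem _ hR)
  by_contra hlt
  rw [not_le, EReal.lt_iff_exists_real_btwn] at hlt
  obtain ⟨R, h1, h2⟩ := hlt
  have h0 : (0 : ℝ) ≤ R := by
    exact_mod_cast ((hle 0 (achievable_zero hP)).trans_lt h1).le
  exact absurd h1 (not_lt.2 (hle R (h R h0 (by exact_mod_cast h2))))

end Achievability

/-! ### The unconditional upper bound. -/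

section UpperBound

variable {X Y Z : Type*} [Fintype X] [Fintype Y] [Fintype Z]

theorem Achievable.le_mutualInfo {P : X × Y × Z → ℝ} (hP : P ∈ stdSimplex ℝ (X × Y × Z))
    {R : ℝ} (hR : Achievable P R) : R ≤ mutualInfo (law P (fun s => (s.1, s.2.1))) := by
  -- Replacing the warden's source by a constant turns the conditional bound into `I(X;Y)`.
  refine (hR.le_condMutualInfo hP (fun _ => ())).trans_eq ?_
  rw [condMutualInfo_law hP.1, mutualInfo_law hP.1,
    rvEntropy_const hP (g := fun _ => ()) (fun _ _ => rfl), sub_zero]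
  congr 1
  · congr 1 <;> exact rvEntropy_congr fun v w => by simp
  · exact rvEntropy_congr fun v w => by simp

end UpperBound

end StealthyKey

end

theorem theorem1 {X Y Z : Type*} [Fintype X] [Fintype Y] [Fintype Z]
    (P : X × Y × Z → ℝ) (hP : P ∈ stdSimplex ℝ (X × Y × Z)) :
    ((max
        (StealthyKey.mutualInfo (StealthyKey.law P (fun s => (s.1, s.2.1))) -
          StealthyKey.mutualInfo (StealthyKey.law P (fun s => (s.1, s.2.2))))
        (StealthyKey.mutualInfo (StealthyKey.law P (fun s => (s.2.1, s.1))) -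
          StealthyKey.mutualInfo (StealthyKey.law P (fun s => (s.2.1, s.2.2)))) : ℝ) : EReal)
      ≤ StealthyKey.capacity P ∧
    StealthyKey.capacity P ≤
      ((min
        (StealthyKey.mutualInfo (StealthyKey.law P (fun s => (s.1, s.2.1))))
        (StealthyKey.condMutualInfo P) : ℝ) : EReal) := by
  constructor
  · refine StealthyKey.le_capacity hP fun R hR0 hR => ?_
    rcases lt_max_iff.1 hR with h | h
    · exact StealthyKey.achievable_of_alice hP hR0 h
    · exact StealthyKey.achievable_of_bob hP hR0 h
  · refine sSup_le ?_
    rintro _ ⟨R, hR, rfl⟩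
    refine EReal.coe_le_coe_iff.2 (le_min (StealthyKey.Achievable.le_mutualInfo hP hR) ?_)
    have h := StealthyKey.Achievable.le_condMutualInfo hP hR (fun z => z)
    rwa [show (fun s : X × Y × Z => (s.1, s.2.1, s.2.2)) = fun s => s from rfl,
      StealthyKey.law_id] at h
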